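/- Let $H$ be a complex Hilbert space, let $\mathcal M\subset B(H)$ be a von Neumann algebra with identity $\mathbf 1$, and let $\mathcal M_1=\{x\in\mathcal M:\|x\|\le 1\}$. A point $x\in\mathcal M_1$ is called a $C^*$-extreme point of $\mathcal M_1$ if, whenever $x=\sum_{i=1}^k t_i^*x_it_i$ with $x_1,\dots,x_k\in\mathcal M_1$ and $t_1,\dots,t_k\in\mathcal M$ invertible such that $\sum_{i=1}^k t_i^*t_i=\mathbf 1$, there exist unitaries $u_1,\dots,u_k\in\mathcal M$ with $x_i=u_i^*xu_i$ for $i=1,\dots,k$. Then the set of $C^*$-extreme points of $\mathcal M_1$ is equal to the set of all isometries ($x^*x=\mathbf 1$) and all coisometries ($xx^*=\mathbf 1$) in $\mathcal M$ if and only if $\mathcal M$ is one of the following: (i) a finite von Neumann algebra; (ii) a properly infinite factor; or (iii) a direct sum of a finite von Neumann algebra and a properly infinite factor. Here a projection $p\in\mathcal M$ is infinite if there is $v\in\mathcal M$ such that $v^*v=p$ and $vv^*$ is a projection with $vv^*\le p$ and $vv^*\ne p$. The algebra $\mathcal M$ is finite if $\mathbf 1$ is not infinite, and properly infinite if $\mathbf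 1$ is infinite and every non-zero central projection of $\mathcal M$ is infinite; it is a factor if its center is $\mathbb C\mathbf 1$. -/

import Mathlib

universe u

section CStarExtreme

variable {A : Type*} [NormedRing A] [StarRing A]

/-- `x` is a C*-extreme point of the closed unit ball of `A`: it lies in the ball and, whenever
`x = ∑ tᵢ* yᵢ tᵢ` with `yᵢ` in the ball, `tᵢ ∈ A` invertible and `∑ tᵢ* tᵢ = 1`
(a proper C*-convex combination), every `yᵢ` is unitarily equivalent to `x` in `A`. -/
def IsCStarExtremePoint (x : A) : Prop :=
  x ∈ Metric.closedBall (0 : A) 1 ∧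
    ∀ (k : ℕ) (t y : Fin k → A),
      (∀ i, IsUnit (t i)) → (∀ i, y i ∈ Metric.closedBall (0 : A) 1) →
      ∑ i, star (t i) * t i = 1 → x = ∑ i, star (t i) * y i * t i →
      ∀ i, ∃ w ∈ unitary A, y i = star w * x * w

end CStarExtreme

section Projections

variable {A : Type*} [Ring A] [StarRing A]

/-- Murray-von Neumann equivalence of the projections `p` and `q` relative to `A`. -/
def MvNEquiv (p q : A) : Prop :=
  ∃ v : A, star v * v = p ∧ v * star v = q

/-- The projection `p` is infinite relative to `A`: it is Murray-von Neumann equivalent to a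
projection `q ≤ p` (that is, `p q = q`) with `q ≠ p`. -/
def IsInfiniteProjection (p : A) : Prop :=
  IsStarProjection p ∧ ∃ q : A, IsStarProjection q ∧ p * q = q ∧ q ≠ p ∧ MvNEquiv p q

/-- The projection `p` is properly infinite relative to `A`: it is infinite, and for every central
projection `z` the projection `z p` is either zero or infinite. -/
def IsProperlyInfiniteProjection (p : A) : Prop :=
  IsInfiniteProjection p ∧
    ∀ z : A, IsStarProjection z → z ∈ Set.center A → z * p = 0 ∨ IsInfiniteProjection (z * p)

end Projections

namespace VonNeumannAlgebra

variable {H : Type u} [NormedAddCommGroup H] [InnerProductSpace ℂ H] [CompleteSpace H]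

/-- A von Neumann algebra is finite if its identity is a finite (not infinite) projection. -/
def IsFinite (M : VonNeumannAlgebra H) : Prop :=
  ¬ IsInfiniteProjection (1 : M.toStarSubalgebra)

/-- A von Neumann algebra is properly infinite if its identity is a properly infinite projection. -/
def IsProperlyInfinite (M : VonNeumannAlgebra H) : Prop :=
  IsProperlyInfiniteProjection (1 : M.toStarSubalgebra)

/-- A von Neumann algebra is a factor if its center consists of the scalar multiples of the
identity. -/
def IsFactor (M : VonNeumannAlgebra H) : Prop :=
  Subalgebra.center ℂ M.toStarSubalgebra = ⊥

/-- `M` is the direct sum of the von Neumann algebras `N` and `R`, up to *-isomorphism.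
A *-isomorphism is automatically isometric for the supremum norm of `N × R`. -/
def IsDirectSum (M : VonNeumannAlgebra H)
    {H₁ : Type u} [NormedAddCommGroup H₁] [InnerProductSpace ℂ H₁] [CompleteSpace H₁]
    {H₂ : Type u} [NormedAddCommGroup H₂] [InnerProductSpace ℂ H₂] [CompleteSpace H₂]
    (N : VonNeumannAlgebra H₁) (R : VonNeumannAlgebra H₂) : Prop :=
  Nonempty (M.toStarSubalgebra ≃⋆ₐ[ℂ] (N.toStarSubalgebra × R.toStarSubalgebra))

end VonNeumannAlgebra

/-! Both sides of the equivalence are compared with `HasFiniteCentralSplittings`: for every central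
projection `z`, either `z` or `1 - z` is finite.

Isometries are always C*-extreme. If an isometry `x` equals `∑ tᵢ* yᵢ tᵢ`, then the positive
elements `|yᵢ tᵢ - tᵢ x|² + tᵢ*(1 - yᵢ* yᵢ)tᵢ` sum to zero, so `yᵢ` is an isometry similar to `x`
through `tᵢ`. Similar isometries are unitarily equivalent inside the algebra, by a Wold
decomposition: their defect projections are equivalent, which intertwines the shift parts, and the
polar part of `tᵢ` intertwines the unitary parts. Adjoints give coisometries.

Conversely, write an extreme point as `x = w h` with `w` a maximal partial isometry and `h = |x|`.
As `h` is the average of a unitary `V` and its adjoint, `x` is the average of `w V` and `w V*`,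
hence unitarily equivalent to `w V`. Maximality means `(1 - ww*) M (1 - w*w) = 0`, so `x` is a
coisometry on some central summand `z` and an isometry on `1 - z`. If one of these summands is
finite, `x` is unitary there, and so is globally an isometry or a coisometry. If instead `z` and `1
- z` are both infinite, a proper isometry on `z` glued to a proper coisometry on `1 - z` is extreme
and is neither.

For the classification, remove the greatest finite central projection. If the algebra is infinite,
what remains is nonzero, all its nonzero central projections are infinite, and a nontrivial one
would violate the splitting condition; so it is a properly infinite factor. -/

/-! ### Range projections and polar decomposition in `B(H)`. -/

section OperatorLemmas

variable {H : Type u} [NormedAddCommGroup H] [InnerProductSpace ℂ H] [CompleteSpace H]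

/-- The projection onto the closed linear span of the ranges of a set of operators. -/
theorem exists_rangeProjection (S : Set (H →L[ℂ] H)) :
    ∃ P : H →L[ℂ] H, IsStarProjection P ∧ (∀ s ∈ S, P * s = s) ∧
      ∀ X : H →L[ℂ] H, (∀ s ∈ S, X * s = 0) → X * P = 0 := by
  let K : Submodule ℂ H := (⨆ s ∈ S, LinearMap.range (s : H →ₗ[ℂ] H)).topologicalClosure
  have : CompleteSpace K :=
    (Submodule.isClosed_topologicalClosure _).completeSpace_coe
  refine ⟨K.starProjection, isStarProjection_starProjection, fun s hs => ?_, fun X hX => ?_⟩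
  · ext ξ
    refine Submodule.starProjection_eq_self_iff.2 (Submodule.le_topologicalClosure _ ?_)
    exact Submodule.mem_iSup_of_mem s (Submodule.mem_iSup_of_mem hs ⟨ξ, rfl⟩)
  · have hK : K ≤ LinearMap.ker (X : H →ₗ[ℂ] H) := by
      refine Submodule.topologicalClosure_minimal _ ?_ X.isClosed_ker
      refine iSup₂_le fun s hs => ?_
      rintro _ ⟨ξ, rfl⟩
      exact congrArg (fun T : H →L[ℂ] H => T ξ) (hX s hs)
    ext ξ
    exact hK (Submodule.starProjection_apply_mem K ξ)

/-- Douglas factorization. -/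
theorem exists_mul_eq_of_norm_apply_le (T h : H →L[ℂ] H) (hT : ∀ ξ, ‖T ξ‖ ≤ ‖h ξ‖) :
    ∃ U : H →L[ℂ] H, U * h = T := by
  let R : Submodule ℂ H := LinearMap.range (h : H →ₗ[ℂ] H)
  let K : Submodule ℂ H := R.topologicalClosure
  have : CompleteSpace K := (Submodule.isClosed_topologicalClosure _).completeSpace_coe
  let e : H →ₗ[ℂ] K := (h : H →ₗ[ℂ] H).codRestrict K
    fun ξ => Submodule.le_topologicalClosure _ ⟨ξ, rfl⟩
  have he : DenseRange e := by
    intro k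
    rw [closure_subtype]
    have h1 : ((↑) '' Set.range e : Set H) = R := by
      ext ξ
      constructor
      · rintro ⟨_, ⟨η, rfl⟩, rfl⟩
        exact ⟨η, rfl⟩
      · rintro ⟨η, rfl⟩
        exact ⟨e η, ⟨η, rfl⟩, rfl⟩
    rw [h1]
    exact k.2
  -- `U` sends `h ξ` to `T ξ`, extends by continuity to the closure of the range of `h`, and
  -- vanishes on the orthogonal complement.
  refine ⟨((T : H →ₗ[ℂ] H).extendOfNorm e) ∘L K.orthogonalProjectionOnto, ?_⟩
  ext ξ
  have h2 : K.orthogonalProjectionOnto (h ξ) = e ξ :=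
    Submodule.orthogonalProjectionOnto_mem_subspace_eq_self (e ξ)
  change ((T : H →ₗ[ℂ] H).extendOfNorm e) (K.orthogonalProjectionOnto (h ξ)) = T ξ
  rw [h2]
  exact LinearMap.extendOfNorm_eq he ⟨1, fun η => (hT η).trans (one_mul ‖h η‖).ge⟩ ξ

theorem norm_apply_eq_of_star_mul_self_eq {S T : H →L[ℂ] H} (h : star S * S = star T * T) (ξ : H) :
    ‖S ξ‖ = ‖T ξ‖ := by
  have h1 := S.apply_norm_sq_eq_inner_adjoint_left ξ
  have h2 := T.apply_norm_sq_eq_inner_adjoint_left ξ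
  rw [← ContinuousLinearMap.star_eq_adjoint] at h1 h2
  have h3 : ‖S ξ‖ ^ 2 = ‖T ξ‖ ^ 2 := by
    rw [h1, h2]
    exact congrArg (fun X : H →L[ℂ] H => RCLike.re (inner ℂ (X ξ) ξ)) h
  exact (sq_eq_sq₀ (norm_nonneg _) (norm_nonneg _)).1 h3

theorem commute_cfcAbs {S T : H →L[ℂ] H} (h : Commute (star T * T) S) : Commute (CFC.abs T) S :=
  h.cfcₙ_nnreal _

/-- Polar decomposition. -/
theorem exists_polar (T : H →L[ℂ] H) :
    ∃ h U : H →L[ℂ] H, h = CFC.abs T ∧ U * h = T ∧ U * star U * U = U ∧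
      (∀ X, X * h = 0 → X * star U = 0) ∧ (∀ X, X * T = 0 → X * U = 0) ∧
      ∀ S : H →L[ℂ] H, Commute S T → Commute (star S) T → Commute S U := by
  set h := CFC.abs T with hdef
  have hsa : star h = h := (CFC.abs_nonneg T).isSelfAdjoint.star_eq
  have hh : h * h = star T * T := CFC.abs_mul_abs T
  obtain ⟨U₀, hU₀⟩ := exists_mul_eq_of_norm_apply_le T h
    fun ξ => (norm_apply_eq_of_star_mul_self_eq (by rw [hsa, hh]) ξ).le
  obtain ⟨P, hP, hPh, hPX⟩ := exists_rangeProjection {h}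
  simp only [Set.mem_singleton_iff, forall_eq] at hPh hPX
  obtain ⟨hPP, hPs⟩ := isStarProjection_iff'.1 hP
  -- Cutting `U₀` down by the range projection `P` of `h` keeps the factorization and makes the
  -- factor a partial isometry with initial projection `P`.
  have hU : U₀ * P * h = T := by rw [mul_assoc, hPh, hU₀]
  have hUP : U₀ * P * P = U₀ * P := by rw [mul_assoc, hPP]
  generalize U₀ * P = U at hU hUP
  have hPU : P * star U = star U := by
    conv_rhs => rw [← hUP, star_mul, hPs]
  have hhP : h * P = h := by
    have := congrArg star hPh
    rwa [star_mul, hPs, hsa] at this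
  have hUU : star U * U = P := by
    have h1 : h * (star U * U - P) * h = 0 := by
      have : h * (star U * U) * h = star T * T := by
        rw [← hU, star_mul, hsa]; simp only [mul_assoc]
      rw [mul_sub, sub_mul, this, hhP, hh, sub_self]
    have h2 : (h * (star U * U - P)) * P = 0 := hPX _ h1
    have h3 : (star U * U - P) * P = star U * U - P := by
      rw [sub_mul, hPP, mul_assoc, hUP]
    have h4 : (star U * U - P) * h = 0 := by
      rw [mul_assoc, h3] at h2
      have := congrArg star h2
      simpa [star_mul, hsa, hPs] using this
    have h5 := hPX _ h4
    rw [h3] at h5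
    exact sub_eq_zero.1 h5
  refine ⟨h, U, rfl, hU, by rw [mul_assoc, hUU, hUP], fun X hX => ?_, fun X hX => ?_,
    fun S hST hST' => ?_⟩
  · rw [← hPU, ← mul_assoc, hPX X hX, zero_mul]
  · have : X * U * P = 0 := hPX _ (by rw [mul_assoc, hU, hX])
    rwa [mul_assoc, hUP] at this
  · have c1 : Commute S (star T) := by simpa using hST'.star_star
    have c2 : Commute S h := (commute_cfcAbs (c1.symm.mul_left hST.symm)).symm
    have c3 : Commute (star S) h := by
      have := c2.star_star
      rwa [hsa] at this
    -- An operator commuting with `h` leaves its range invariant; used for `S` and `star S`, this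
    -- makes `S` commute with `P`.
    have key : ∀ S : H →L[ℂ] H, Commute S h → P * S * P = S * P := by
      intro S hS
      have : (1 - P) * S * P = 0 := hPX _ (by
        rw [mul_assoc, hS.eq, ← mul_assoc, sub_mul, one_mul, hPh, sub_self, zero_mul])
      rw [sub_mul, sub_mul, one_mul, sub_eq_zero] at this
      exact this.symm
    have k1 := key S c2
    have k2 := congrArg star (key (star S) c3)
    simp only [star_mul, star_star, hPs, ← mul_assoc] at k2
    have c4 : S * P = P * S := k1.symm.trans k2
    have h1 : (S * U - U * S) * P = 0 := hPX _ (by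
      rw [sub_mul, mul_assoc, hU, mul_assoc, c2.eq, ← mul_assoc, hU, hST.eq, sub_self])
    rw [sub_mul, mul_assoc, hUP, mul_assoc, c4, ← mul_assoc, hUP, sub_eq_zero] at h1
    exact h1

end OperatorLemmas

/-! ### The extension order on partial isometries and strong limits of chains. -/

/-- For partial isometries, `b` extends `a` and `star b` extends `star a`. -/
def StarExtends {A : Type*} [Mul A] [Star A] (a b : A) : Prop :=
  star a * b = star a * a ∧ b * star a = a * star a

/-- Since `star a = star a * a * star b`, the product of `c` with `star b` determines its product
with `star a`; the other side is symmetric. Only `a` has to be a partial isometry. -/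
theorem StarExtends.trans {A : Type*} [Semigroup A] [StarMul A] {a b c : A}
    (hab : StarExtends a b) (ha : a * star a * a = a) (hbc : StarExtends b c) :
    StarExtends a c := by
  have h1 := congrArg star hab.1
  have h2 := congrArg star hab.2
  simp only [star_mul, star_star] at h1 h2
  have ha' : star a * a * star a = star a := by
    have := congrArg star ha
    simpa only [star_mul, star_star, mul_assoc] using this
  have e1 : star a * a * star b = star a := by rw [mul_assoc, h2, ← mul_assoc, ha']
  have e2 : star b * a * star a = star a := by rw [h1, ha']
  constructor
  · conv_lhs => rw [← e1, mul_assoc, hbc.1, ← mul_assoc, e1, hab.1]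
  · conv_lhs => rw [← e2, mul_assoc, ← mul_assoc, hbc.2, mul_assoc, ← mul_assoc (star b), e2, hab.2]

theorem exists_strongLimit {H : Type*} [NormedAddCommGroup H] [InnerProductSpace ℂ H]
    (F : Filter (H →L[ℂ] H)) [F.NeBot]
    (hb : ∀ᶠ b in F, ∀ ξ, ‖b ξ‖ ≤ ‖ξ‖)
    (h : ∀ ξ, ∃ η, Filter.Tendsto (fun b : H →L[ℂ] H => b ξ) F (nhds η)) :
    ∃ s : H →L[ℂ] H, ∀ ξ, Filter.Tendsto (fun b : H →L[ℂ] H => b ξ) F (nhds (s ξ)) := by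
  choose f hf using h
  let g : H →ₗ[ℂ] H :=
    { toFun := f
      map_add' := fun ξ η => tendsto_nhds_unique (hf (ξ + η)) (by
        simpa only [map_add] using (hf ξ).add (hf η))
      map_smul' := fun c ξ => tendsto_nhds_unique (hf (c • ξ)) (by
        simpa only [map_smul] using! (hf ξ).const_smul c) }
  refine ⟨g.mkContinuous 1 fun ξ => ?_, hf⟩
  rw [one_mul]
  exact le_of_tendsto (hf ξ).norm (hb.mono fun b hb => hb ξ)

section Chains

variable {H : Type u} [NormedAddCommGroup H] [InnerProductSpace ℂ H] [CompleteSpace H]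

/-- Pythagoras: `b ξ - a ξ` is orthogonal to `a ξ`, because `star a * (b - a) = 0`. -/
theorem StarExtends.norm_sub_apply_sq {a b : H →L[ℂ] H} (h : StarExtends a b) (ξ : H) :
    ‖b ξ - a ξ‖ ^ 2 = ‖b ξ‖ ^ 2 - ‖a ξ‖ ^ 2 := by
  have h1 : inner ℂ (a ξ) (b ξ) = inner ℂ (a ξ) (a ξ) := by
    have := congrArg (fun X : H →L[ℂ] H => inner ℂ ξ (X ξ)) h.1
    simpa [ContinuousLinearMap.star_eq_adjoint, ContinuousLinearMap.adjoint_inner_right] using this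
  rw [norm_sub_sq (𝕜 := ℂ), ← inner_conj_symm, h1, inner_conj_symm, inner_self_eq_norm_sq]
  ring

theorem norm_apply_le_of_partialIsometry {a : H →L[ℂ] H} (h : a * star a * a = a) (ξ : H) :
    ‖a ξ‖ ≤ ‖ξ‖ := by
  have h0 : ‖star a * a‖ ≤ 1 := by
    have h1 : star a * a * (star a * a) = star a * a := by
      rw [mul_assoc, ← mul_assoc a, h]
    exact IsStarProjection.norm_le _ (isStarProjection_iff'.2 ⟨h1, by simp⟩)
  have h2 : ‖a‖ ≤ 1 := by
    rw [CStarRing.norm_star_mul_self] at h0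
    nlinarith [norm_nonneg a]
  exact (a.le_of_opNorm_le h2 ξ).trans_eq (one_mul _)

/-- Along the chain `‖a ξ‖²` increases and is bounded by `‖ξ‖²`. By Pythagoras its increments are
the squared distances, so the net `a ξ` is Cauchy. -/
theorem exists_tendsto_of_isChain_starExtends {C : Set (H →L[ℂ] H)} (hne : C.Nonempty)
    (hC : ∀ a ∈ C, a * star a * a = a)
    (hch : ∀ a ∈ C, ∀ b ∈ C, StarExtends a b ∨ StarExtends b a) (ξ : H) :
    ∃ η, ∀ ε > 0, ∃ a ∈ C, ∀ b ∈ C, StarExtends a b → ‖b ξ - η‖ < ε := by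
  have key : ∀ a ∈ C, ∀ b ∈ C, StarExtends a b → ‖a ξ‖ ^ 2 ≤ ‖b ξ‖ ^ 2 := fun a _ b _ h => by
    have := h.norm_sub_apply_sq ξ
    nlinarith [sq_nonneg ‖b ξ - a ξ‖]
  let f : C → ℝ := fun a => ‖a.1 ξ‖ ^ 2
  have : Nonempty C := hne.to_subtype
  have hbdd : BddAbove (Set.range f) := ⟨‖ξ‖ ^ 2, by
    rintro _ ⟨a, rfl⟩
    exact pow_le_pow_left₀ (norm_nonneg _) (norm_apply_le_of_partialIsometry (hC a a.2) ξ) 2⟩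
  have hclose : ∀ δ > 0, ∃ a ∈ C, ∀ b ∈ C, StarExtends a b → ∀ c ∈ C, StarExtends a c →
      ‖b ξ - c ξ‖ < δ := by
    intro δ hδ
    obtain ⟨a, ha⟩ := exists_lt_of_lt_ciSup (f := f) (sub_lt_self (⨆ x, f x) (pow_pos hδ 2))
    refine ⟨a, a.2, ?_⟩
    have main : ∀ b ∈ C, StarExtends a.1 b → ∀ c ∈ C, StarExtends b c → ‖c ξ - b ξ‖ < δ := by
      intro b hb hab c hc hbc
      have h1 := hbc.norm_sub_apply_sq ξ
      have h2 := key a a.2 b hb hab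
      have h3 : ‖c ξ‖ ^ 2 ≤ ⨆ x, f x := le_ciSup hbdd ⟨c, hc⟩
      refine lt_of_pow_lt_pow_left₀ 2 hδ.le ?_
      change _ < ‖a.1 ξ‖ ^ 2 at ha
      linarith
    intro b hb hab c hc hac
    rcases hch b hb c hc with h | h
    · rw [norm_sub_rev]
      exact main b hb hab c hc h
    · exact main c hc hac b hb h
  -- `s δ` is a member beyond which all values at `ξ` lie within `δ` of each other. Two such members
  -- are comparable, so `s (1 / (n + 1)) ξ` is a Cauchy sequence.
  choose! s hs hsC using hclose
  have hself : ∀ a : H →L[ℂ] H, StarExtends a a := fun a => ⟨rfl, rfl⟩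
  let r : ℕ → ℝ := fun n => 1 / ((n : ℝ) + 1)
  have hr : ∀ n, 0 < r n := fun n => Nat.one_div_pos_of_nat
  have hr0 : Filter.Tendsto r Filter.atTop (nhds 0) := tendsto_one_div_add_atTop_nhds_zero_nat
  have hsr : ∀ n m, ‖s (r n) ξ - s (r m) ξ‖ < max (r n) (r m) := by
    intro n m
    rcases hch _ (hs _ (hr n)) _ (hs _ (hr m)) with h | h
    · exact (hsC _ (hr n) _ (hs _ (hr n)) (hself _) _ (hs _ (hr m)) h).trans_le (le_max_left _ _)
    · exact (hsC _ (hr m) _ (hs _ (hr n)) h _ (hs _ (hr m)) (hself _)).trans_le (le_max_right _ _)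
  have hcau : CauchySeq fun n => s (r n) ξ := by
    rw [Metric.cauchySeq_iff]
    intro ε hε
    obtain ⟨N, hN⟩ := Filter.eventually_atTop.1 (hr0.eventually (gt_mem_nhds hε))
    refine ⟨N, fun m hm n hn => ?_⟩
    rw [dist_eq_norm]
    exact (hsr m n).trans (max_lt (hN m hm) (hN n hn))
  obtain ⟨η, hη⟩ := cauchySeq_tendsto_of_complete hcau
  refine ⟨η, fun ε hε => ?_⟩
  obtain ⟨n, hn1, hn2⟩ := ((hr0.eventually (gt_mem_nhds (half_pos hε))).and
    ((Metric.tendsto_nhds.1 hη) _ (half_pos hε))).exists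
  refine ⟨s (r n), hs _ (hr n), fun b hb hab => ?_⟩
  have h1 := hsC _ (hr n) b hb hab _ (hs _ (hr n)) (hself _)
  rw [dist_eq_norm] at hn2
  calc ‖b ξ - η‖ = ‖(b ξ - s (r n) ξ) + (s (r n) ξ - η)‖ := by congr 1; abel
    _ ≤ _ := norm_add_le _ _
    _ < ε := by linarith

/-- A chain of partial isometries has a strong limit, which extends all of them. -/
theorem exists_sup_of_isChain_starExtends {C : Set (H →L[ℂ] H)} (hne : C.Nonempty)
    (hC : ∀ a ∈ C, a * star a * a = a)
    (hch : ∀ a ∈ C, ∀ b ∈ C, StarExtends a b ∨ StarExtends b a) :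
    ∃ s : H →L[ℂ] H, (∀ a ∈ C, StarExtends a s) ∧ (∀ X, (∀ a ∈ C, X * a = 0) → X * s = 0) ∧
      (∀ X, (∀ a ∈ C, a * X = 0) → s * X = 0) ∧
      ∀ X, (∀ a ∈ C, Commute X a) → Commute X s := by
  have htrans : ∀ a ∈ C, ∀ b ∈ C, ∀ c, StarExtends a b → StarExtends b c → StarExtends a c :=
    fun a ha b _ c hab hbc => hab.trans (hC a ha) hbc
  -- The filter of tails of the chain, which need not have a cofinal sequence.
  let F : Filter (H →L[ℂ] H) := ⨅ a ∈ C, Filter.principal {b | b ∈ C ∧ StarExtends a b}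
  have hF : F.HasBasis (fun a => a ∈ C) fun a => {b | b ∈ C ∧ StarExtends a b} := by
    refine Filter.hasBasis_biInf_principal ?_ hne
    intro a ha b hb
    rcases hch a ha b hb with h | h
    · exact ⟨b, hb, fun c hc => ⟨hc.1, htrans a ha b hb c h hc.2⟩, fun c hc => hc⟩
    · exact ⟨a, ha, fun c hc => hc, fun c hc => ⟨hc.1, htrans b hb a ha c h hc.2⟩⟩
  have hev : ∀ a ∈ C, ∀ᶠ b in F, b ∈ C ∧ StarExtends a b := fun a ha => hF.mem_of_mem ha
  have hNe : F.NeBot := hF.neBot_iff.2 fun {a} ha => ⟨a, ha, rfl, rfl⟩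
  have hevC : ∀ᶠ b in F, b ∈ C := by
    obtain ⟨a, ha⟩ := hne
    exact (hev a ha).mono fun b hb => hb.1
  obtain ⟨s, hs⟩ := exists_strongLimit F
    (hevC.mono fun b hb => norm_apply_le_of_partialIsometry (hC b hb)) fun ξ => by
      obtain ⟨η, hη⟩ := exists_tendsto_of_isChain_starExtends hne hC hch ξ
      refine ⟨η, Metric.tendsto_nhds.2 fun ε hε => ?_⟩
      obtain ⟨a, ha, h⟩ := hη ε hε
      exact (hev a ha).mono fun b hb => by simpa [dist_eq_norm] using h b hb.1 hb.2
  have hsX : ∀ X Y : H →L[ℂ] H, ∀ ξ,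
      Filter.Tendsto (fun b : H →L[ℂ] H => (X * b * Y) ξ) F (nhds ((X * s * Y) ξ)) :=
    fun X Y ξ => (X.continuous.tendsto _).comp (hs (Y ξ))
  have heq : ∀ X Y Z : H →L[ℂ] H, (∀ᶠ b in F, X * b * Y = Z) → X * s * Y = Z := by
    intro X Y Z h
    ext ξ
    exact tendsto_nhds_unique (hsX X Y ξ)
      (tendsto_const_nhds.congr' (h.mono fun b hb => congrArg (fun T : H →L[ℂ] H => T ξ) hb.symm))
  refine ⟨s, fun a ha => ⟨?_, ?_⟩, fun X hX => ?_, fun X hX => ?_, fun X hX => ?_⟩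
  · simpa using heq (star a) 1 (star a * a) ((hev a ha).mono fun b hb => by simp [hb.2.1])
  · simpa using heq 1 (star a) (a * star a) ((hev a ha).mono fun b hb => by simp [hb.2.2])
  · simpa using heq X 1 0 (hevC.mono fun b hb => by simp [hX b hb])
  · simpa using heq 1 X 0 (hevC.mono fun b hb => by simp [hX b hb])
  · ext ξ
    have h1 := hsX X 1 ξ
    have h2 := hsX 1 X ξ
    simp only [mul_one, one_mul] at h1 h2
    exact tendsto_nhds_unique h1 (h2.congr' (hevC.mono fun b hb =>
      congrArg (fun T : H →L[ℂ] H => T ξ) (hX b hb).eq.symm))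

end Chains

/-! ### The same constructions inside a von Neumann algebra, by the bicommutant theorem. -/

namespace VonNeumannAlgebra

variable {H : Type u} [NormedAddCommGroup H] [InnerProductSpace ℂ H] [CompleteSpace H]
  (M : VonNeumannAlgebra H)

theorem mem_of_commute {T : H →L[ℂ] H} (h : ∀ S ∈ M.commutant, Commute S T) :
    T ∈ M.toStarSubalgebra := by
  have : T ∈ M.commutant.commutant := mem_commutant_iff.2 fun S hS => (h S hS).eq
  rwa [commutant_commutant] at this

theorem commute_of_mem {S T : H →L[ℂ] H} (hS : S ∈ M.commutant) (hT : T ∈ M.toStarSubalgebra) :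
    Commute S T :=
  (mem_commutant_iff.1 hS T hT).symm

theorem exists_rangeProjection (S : Set M.toStarSubalgebra) :
    ∃ p : M.toStarSubalgebra, IsStarProjection p ∧ (∀ s ∈ S, p * s = s) ∧
      ∀ x : M.toStarSubalgebra, (∀ s ∈ S, x * s = 0) → x * p = 0 := by
  obtain ⟨P, hP, hPs, hPX⟩ := _root_.exists_rangeProjection (Subtype.val '' S)
  obtain ⟨hPP, hPa⟩ := isStarProjection_iff'.1 hP
  -- Each `T` in the commutant preserves the ranges of the members of `S`, hence the range of `P`;
  -- the adjoint of `T` does too, so `T` commutes with `P`.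
  have key : ∀ T ∈ M.commutant, P * T * P = T * P := by
    intro T hT
    have : (1 - P) * T * P = 0 := hPX _ (by
      rintro _ ⟨s, hs, rfl⟩
      rw [mul_assoc, (M.commute_of_mem hT s.2).eq, ← mul_assoc, sub_mul, one_mul,
        hPs _ ⟨s, hs, rfl⟩, sub_self, zero_mul])
    rw [sub_mul, sub_mul, one_mul, sub_eq_zero] at this
    exact this.symm
  have hmem : P ∈ M.toStarSubalgebra := M.mem_of_commute fun T hT => by
    have k1 := key T hT
    have k2 := congrArg star (key (star T) (star_mem hT))
    simp only [star_mul, star_star, hPa, ← mul_assoc] at k2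
    exact k1.symm.trans k2
  refine ⟨⟨P, hmem⟩, isStarProjection_iff'.2 ⟨Subtype.ext hPP, Subtype.ext hPa⟩,
    fun s hs => Subtype.ext (hPs _ ⟨s, hs, rfl⟩), fun x hx => Subtype.ext (hPX _ ?_)⟩
  rintro _ ⟨s, hs, rfl⟩
  exact congrArg Subtype.val (hx s hs)

theorem exists_polar (m : M.toStarSubalgebra) :
    ∃ h u : M.toStarSubalgebra, star h = h ∧ h * h = star m * m ∧ u * h = m ∧
      star u * m = h ∧ u * star u * u = u ∧ (∀ x, x * h = 0 → x * star u = 0) ∧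
      (∀ x, x * m = 0 → x * u = 0) ∧ (∀ x, m * x = 0 → u * x = 0) ∧
      ∀ x, Commute x (star m * m) → Commute x h := by
  obtain ⟨h, U, hh, hUh, hU, hX1, hX2, hc⟩ := _root_.exists_polar m.1
  have hmem : h ∈ M.toStarSubalgebra := M.mem_of_commute fun T hT => by
    rw [hh]
    exact (commute_cfcAbs (M.commute_of_mem hT (star m * m).2).symm).symm
  have hUmem : U ∈ M.toStarSubalgebra := M.mem_of_commute fun T hT =>
    hc T (M.commute_of_mem hT m.2) (M.commute_of_mem (star_mem hT) m.2)
  have hsa : star h = h := by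
    rw [hh]
    exact (CFC.abs_nonneg m.1).isSelfAdjoint.star_eq
  have hh2 : h * h = star m.1 * m.1 := by
    rw [hh]
    exact CFC.abs_mul_abs m.1
  have hUm : star U * m.1 = h := by
    have h1 : star (star U * m.1 - h) * (star U * m.1 - h) = 0 := by
      have h2 : star m.1 = h * star U := by rw [← hUh, star_mul, hsa]
      have h3 : star m.1 * U * star U * m.1 = h * h := by
        calc star m.1 * U * star U * m.1 = h * star U * (U * star U * U) * h := by
              rw [h2]
              conv_lhs => rw [← hUh]
              simp only [mul_assoc]
          _ = h * h := by rw [hU, ← h2, mul_assoc, hUh, hh2]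
      rw [star_sub, star_mul, star_star, hsa, sub_mul, mul_sub, mul_sub, ← mul_assoc, h3,
        mul_assoc, hUh, ← mul_assoc, ← h2, ← hh2, sub_self]
    exact sub_eq_zero.1 ((CStarRing.star_mul_self_eq_zero_iff _).1 h1)
  refine ⟨⟨h, hmem⟩, ⟨U, hUmem⟩, Subtype.ext hsa, Subtype.ext hh2, Subtype.ext hUh,
    Subtype.ext hUm, Subtype.ext hU,
    fun x hx => Subtype.ext (hX1 _ (congrArg Subtype.val hx)),
    fun x hx => Subtype.ext (hX2 _ (congrArg Subtype.val hx)), fun x hx => Subtype.ext ?_,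
    fun x hx => Subtype.ext ?_⟩
  · have hx' : m.1 * x.1 = 0 := congrArg Subtype.val hx
    have h1 : h * x.1 = 0 := by rw [← hUm, mul_assoc, hx', mul_zero]
    have h2 : star x.1 * h = 0 := by
      have := congrArg star h1
      simpa only [star_mul, hsa, star_zero] using this
    have := congrArg star (hX1 _ h2)
    simpa only [star_mul, star_star, star_zero] using! this
  · change x.1 * h = h * x.1
    rw [hh]
    exact (commute_cfcAbs (congrArg Subtype.val hx).symm).symm.eq

theorem exists_sup_of_isChain_starExtends {C : Set M.toStarSubalgebra} (hne : C.Nonempty)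
    (hC : ∀ a ∈ C, a * star a * a = a)
    (hch : ∀ a ∈ C, ∀ b ∈ C, StarExtends a b ∨ StarExtends b a) :
    ∃ s : M.toStarSubalgebra, s * star s * s = s ∧ (∀ a ∈ C, StarExtends a s) ∧
      (∀ x, (∀ a ∈ C, x * a = 0) → x * s = 0) ∧ ∀ x, (∀ a ∈ C, a * x = 0) → s * x = 0 := by
  have hval : ∀ {a b : M.toStarSubalgebra}, StarExtends a b → StarExtends a.1 b.1 := fun h =>
    ⟨congrArg Subtype.val h.1, congrArg Subtype.val h.2⟩
  obtain ⟨s, hs, hX1, hX2, hc⟩ := _root_.exists_sup_of_isChain_starExtends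
    (hne.image Subtype.val)
    (by rintro _ ⟨a, ha, rfl⟩; exact congrArg Subtype.val (hC a ha))
    (by
      rintro _ ⟨a, ha, rfl⟩ _ ⟨b, hb, rfl⟩
      exact (hch a ha b hb).imp hval hval)
  have hmem : s ∈ M.toStarSubalgebra := M.mem_of_commute fun T hT => hc T (by
    rintro _ ⟨a, ha, rfl⟩
    exact M.commute_of_mem hT a.2)
  have hs' : ∀ a ∈ C, StarExtends a (⟨s, hmem⟩ : M.toStarSubalgebra) := fun a ha =>
    ⟨Subtype.ext (hs _ ⟨a, ha, rfl⟩).1, Subtype.ext (hs _ ⟨a, ha, rfl⟩).2⟩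
  have hX1' : ∀ x : M.toStarSubalgebra, (∀ a ∈ C, x * a = 0) → x * ⟨s, hmem⟩ = 0 :=
    fun x hx => Subtype.ext (hX1 _ (by
      rintro _ ⟨a, ha, rfl⟩
      exact congrArg Subtype.val (hx a ha)))
  refine ⟨⟨s, hmem⟩, ?_, hs', hX1', fun x hx => Subtype.ext (hX2 _ ?_)⟩
  · generalize (⟨s, hmem⟩ : M.toStarSubalgebra) = s at hs' hX1'
    have := hX1' (s * star s - 1) fun a ha => by
      have h1 := congrArg star (hs' a ha).1
      simp only [star_mul, star_star] at h1
      rw [sub_mul, mul_assoc, h1, ← mul_assoc, (hs' a ha).2, hC a ha, one_mul, sub_self]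
    rwa [sub_mul, one_mul, sub_eq_zero] at this
  · rintro _ ⟨a, ha, rfl⟩
    exact congrArg Subtype.val (hx a ha)

end VonNeumannAlgebra

/-! ### Partial isometries, central projections and averages of unitaries. -/

section StarRing

variable {A : Type*} [Ring A] [StarRing A]

theorem isStarProjection_star_mul_self {u : A} (hu : u * star u * u = u) :
    IsStarProjection (star u * u) := by
  refine isStarProjection_iff'.2 ⟨?_, by rw [star_mul, star_star]⟩
  rw [mul_assoc, ← mul_assoc u, hu]

theorem star_mul_self_mul_star {u : A} (hu : u * star u * u = u) :
    star u * u * star u = star u := by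
  have := congrArg star hu
  simpa only [star_mul, star_star, mul_assoc] using this

/-- A criterion for the centrality of a projection. -/
theorem IsStarProjection.mem_center_of_mul_mul {z : A} (hz : IsStarProjection z)
    (h : ∀ b, (1 - z) * b * z = 0) : z ∈ Set.center A := by
  obtain ⟨-, hzs⟩ := isStarProjection_iff'.1 hz
  rw [Semigroup.mem_center_iff]
  intro b
  have h1 : z * b * z = b * z := by
    have := h b
    rw [sub_mul, sub_mul, one_mul, sub_eq_zero] at this
    exact this.symm
  have h2 : z * b * z = z * b := by
    have := h (star b)
    rw [sub_mul, sub_mul, one_mul, sub_eq_zero] at this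
    have := congrArg star this
    simp only [star_mul, star_star, hzs, ← mul_assoc] at this
    exact this.symm
  exact h1.symm.trans h2

end StarRing

section CStarRing

variable {A : Type*} [NormedRing A] [StarRing A] [CStarRing A]

theorem norm_le_one_of_partialIsometry {u : A} (hu : u * star u * u = u) : ‖u‖ ≤ 1 := by
  have h1 := IsStarProjection.norm_le _ (isStarProjection_star_mul_self hu)
  rw [CStarRing.norm_star_mul_self] at h1
  nlinarith [norm_nonneg u]

theorem norm_le_one_of_star_mul_self {u : A} (hu : star u * u = 1) : ‖u‖ ≤ 1 :=
  norm_le_one_of_partialIsometry (by rw [mul_assoc, hu, mul_one])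

end CStarRing

/-- The unitary is `h + i √(1 - h²)`. -/
theorem exists_unitary_add_star_eq {A : Type*} [CStarAlgebra A] {h : A} (hh : star h = h)
    (hh1 : ‖h‖ ≤ 1) : ∃ V ∈ unitary A, V + star V = (2 : ℂ) • h := by
  let _ := CStarAlgebra.spectralOrder A
  have := CStarAlgebra.spectralOrderedRing A
  have hs : star (CFC.sqrt (1 - h ^ 2)) = CFC.sqrt (1 - h ^ 2) :=
    (CFC.sqrt_nonneg (1 - h ^ 2 : A)).isSelfAdjoint.star_eq
  refine ⟨_, IsSelfAdjoint.self_add_I_smul_cfcSqrt_sub_sq_mem_unitary h hh hh1, ?_⟩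
  rw [star_add, star_smul, hs, hh, two_smul]
  simp only [RCLike.star_def, Complex.conj_I, neg_smul]
  abel

/-! ### Maximal partial isometries and the central splitting of a C*-extreme point. -/

namespace VonNeumannAlgebra

variable {H : Type u} [NormedAddCommGroup H] [InnerProductSpace ℂ H] [CompleteSpace H]
  (M : VonNeumannAlgebra H)

theorem isClosed_toStarSubalgebra : IsClosed (M.toStarSubalgebra : Set (H →L[ℂ] H)) := by
  rw [coe_toStarSubalgebra, ← centralizer_centralizer]
  exact Set.isClosed_centralizer _

/-- A von Neumann algebra as an abstract C*-algebra. -/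
noncomputable abbrev cstarAlgebra : CStarAlgebra M.toStarSubalgebra :=
  StarSubalgebra.cstarAlgebra _ (h_closed := M.isClosed_toStarSubalgebra)

attribute [local instance] cstarAlgebra

theorem star_mul_self_eq_zero {x : M.toStarSubalgebra} (h : star x * x = 0) : x = 0 :=
  (CStarRing.star_mul_self_eq_zero_iff x).1 h

/-- Every partial isometry extends to a maximal one. -/
theorem exists_maximal_starExtends {u : M.toStarSubalgebra} (hu : u * star u * u = u) :
    ∃ w, w * star w * w = w ∧ StarExtends u w ∧
      ∀ m, (1 - w * star w) * m * (1 - star w * w) = 0 := by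
  obtain ⟨⟨w, hw, huw⟩, hmax⟩ := exists_maximal_of_chains_bounded
    (α := {a : M.toStarSubalgebra // a * star a * a = a ∧ StarExtends u a})
    (r := fun a b => StarExtends a.1 b.1)
    (fun c hc => by
      rcases c.eq_empty_or_nonempty with rfl | hne
      · exact ⟨⟨u, hu, rfl, rfl⟩, fun a ha => ha.elim⟩
      · obtain ⟨s, hs, hs', -⟩ := M.exists_sup_of_isChain_starExtends
          (hne.image Subtype.val)
          (by rintro _ ⟨a, -, rfl⟩; exact a.2.1)
          (by
            rintro _ ⟨a, ha, rfl⟩ _ ⟨b, hb, rfl⟩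
            rcases eq_or_ne a b with rfl | hab
            · exact Or.inl ⟨rfl, rfl⟩
            · exact hc ha hb hab)
        obtain ⟨a, ha⟩ := hne
        exact ⟨⟨s, hs, a.2.2.trans hu (hs' _ ⟨a, ha, rfl⟩)⟩, fun b hb => hs' _ ⟨b, hb, rfl⟩⟩)
    (fun {a b c} hab hbc => hab.trans a.2.1 hbc)
  refine ⟨w, hw, huw, fun m => ?_⟩
  -- The polar part `v` of an element of this corner is orthogonal to `w` on both sides, so `w + v`
  -- is a partial isometry extending `w`; maximality then forces `v = 0`.
  obtain ⟨h, v, -, -, hvh, -, hv, -, hX1, hX2, -⟩ :=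
    M.exists_polar ((1 - w * star w) * m * (1 - star w * w))
  have hws := star_mul_self_mul_star hw
  have h1 : star w * v = 0 := hX1 _ (by
    have h0 : star w * (1 - w * star w) = 0 := by
      rw [mul_sub, mul_one, ← mul_assoc, hws, sub_self]
    rw [← mul_assoc, ← mul_assoc, h0, zero_mul, zero_mul])
  have h2 : v * star w = 0 := hX2 _ (by
    have h0 : (1 - star w * w) * star w = 0 := by rw [sub_mul, one_mul, hws, sub_self]
    rw [mul_assoc, h0, mul_zero])
  have h1' : star v * w = 0 := by simpa using congrArg star h1
  have h2' : w * star v = 0 := by simpa using congrArg star h2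
  have hext : StarExtends w (w + v) := by
    constructor
    · rw [mul_add, h1, add_zero]
    · rw [add_mul, h2, add_zero]
  have hmul : star (w + v) * (w + v) = star w * w + star v * v := by
    rw [star_add, add_mul, mul_add, mul_add, h1, h1', add_zero, zero_add]
  have hpi : (w + v) * star (w + v) * (w + v) = w + v := by
    rw [mul_assoc, hmul, add_mul, mul_add, mul_add, ← mul_assoc, hw, ← mul_assoc w, h2',
      ← mul_assoc v, h2, ← mul_assoc v, hv, zero_mul, zero_mul, add_zero, zero_add]
  have hback := (hmax ⟨w + v, hpi, huw.trans hu hext⟩ hext).1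
  change star (w + v) * w = star (w + v) * (w + v) at hback
  rw [hmul, star_add, add_mul, h1', add_right_inj] at hback
  rw [← hvh, M.star_mul_self_eq_zero hback.symm, zero_mul]

/-- A central projection that splits `x` into a coisometry and an isometry. -/
def IsSplitBy (x z : M.toStarSubalgebra) : Prop :=
  IsStarProjection z ∧ z ∈ Set.center M.toStarSubalgebra ∧
    z * (x * star x) = z ∧ (1 - z) * (star x * x) = 1 - z

/-- Take for `z` the projection onto the ranges of all `b * (1 - star w * w)`. It is central because
left multiplication permutes these elements among themselves. It dominates `1 - star w * w`, and the
hypothesis puts it under `w * star w`. -/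
theorem exists_isSplitBy_of_mul_mul_eq_zero {w : M.toStarSubalgebra}
    (h : ∀ m, (1 - w * star w) * m * (1 - star w * w) = 0) : ∃ z, M.IsSplitBy w z := by
  obtain ⟨z, hz, hzp, hX⟩ := M.exists_rangeProjection (Set.range fun b => b * (1 - star w * w))
  simp only [Set.forall_mem_range] at hzp hX
  obtain ⟨-, hzs⟩ := isStarProjection_iff'.1 hz
  refine ⟨z, hz, hz.mem_center_of_mul_mul fun b => hX _ fun c => ?_, ?_, ?_⟩
  · rw [mul_assoc, ← mul_assoc b, sub_mul, one_mul, hzp, sub_self]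
  · have h1 := hX (1 - w * star w) fun b => by rw [← mul_assoc, h]
    rw [sub_mul, one_mul, sub_eq_zero] at h1
    have := congrArg star h1
    simpa only [star_mul, star_star, hzs, eq_comm] using this
  · have h1 := hzp 1
    rw [one_mul, mul_sub, mul_one] at h1
    rw [sub_mul, one_mul]
    have : star w * w - z * (star w * w) = 1 - z := by
      calc star w * w - z * (star w * w) = z - z * (star w * w) - z + star w * w := by abel
        _ = 1 - z := by rw [h1]; abel
    exact this

variable {M} in
theorem IsSplitBy.unitary_mul_mul {x z a b : M.toStarSubalgebra} (h : M.IsSplitBy x z)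
    (ha : a ∈ unitary M.toStarSubalgebra) (hb : b ∈ unitary M.toStarSubalgebra) :
    M.IsSplitBy (a * x * b) z := by
  obtain ⟨hz, hzc, h1, h2⟩ := h
  have hc := Semigroup.mem_center_iff.1 hzc
  refine ⟨hz, hzc, ?_, ?_⟩
  · calc z * (a * x * b * star (a * x * b))
        = z * a * x * (b * star b) * star x * star a := by simp only [star_mul, mul_assoc]
      _ = a * (z * (x * star x)) * star a := by
          rw [Unitary.mul_star_self_of_mem hb, ← hc a]; simp only [mul_one, mul_assoc]
      _ = z := by rw [h1, hc a, mul_assoc, Unitary.mul_star_self_of_mem ha, mul_one]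
  · have hc' : ∀ g, g * (1 - z) = (1 - z) * g := fun g => by
      rw [mul_sub, sub_mul, mul_one, one_mul, hc g]
    calc (1 - z) * (star (a * x * b) * (a * x * b))
        = (1 - z) * star b * star x * (star a * a) * x * b := by simp only [star_mul, mul_assoc]
      _ = star b * ((1 - z) * (star x * x)) * b := by
          rw [Unitary.star_mul_self_of_mem ha, ← hc' (star b)]; simp only [mul_one, mul_assoc]
      _ = 1 - z := by rw [h2, hc' (star b), mul_assoc, Unitary.star_mul_self_of_mem hb, mul_one]

theorem exists_isSplitBy_of_isCStarExtremePoint {x : M.toStarSubalgebra}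
    (hx : IsCStarExtremePoint x) : ∃ z, M.IsSplitBy x z := by
  obtain ⟨h, u, hh, hhh, huh, hux, hu, -⟩ := M.exists_polar x
  obtain ⟨w, hw, huw, hwm⟩ := M.exists_maximal_starExtends hu
  -- `w` may replace `u` here: `h = star u * x`, and `w * star u = u * star u`.
  have hwh : w * h = x := by
    have h1 : u * star u * u * h = x := by rw [hu, huh]
    rw [← huw.2, mul_assoc, mul_assoc, huh, hux] at h1
    exact h1
  have hx1 : ‖x‖ ≤ 1 := by simpa using hx.1
  have hh1 : ‖h‖ ≤ 1 := by
    have h2 : ‖h‖ * ‖h‖ = ‖x‖ * ‖x‖ := by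
      rw [← CStarRing.norm_star_mul_self, hh, hhh, CStarRing.norm_star_mul_self]
    nlinarith [norm_nonneg h, norm_nonneg x]
  obtain ⟨V, hVu, hVh⟩ := exists_unitary_add_star_eq hh hh1
  have hwV : ∀ V ∈ unitary M.toStarSubalgebra,
      w * V ∈ Metric.closedBall (0 : M.toStarSubalgebra) 1 := fun V hV => by
    rw [mem_closedBall_zero_iff]
    refine (norm_mul_le _ _).trans (mul_le_one₀ (norm_le_one_of_partialIsometry hw)
      (norm_nonneg _) (norm_le_one_of_star_mul_self (Unitary.star_mul_self_of_mem hV)))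
  -- The scalar coefficients `1/√2` are invertible, and two of them turn the C*-convex combination
  -- into the midpoint of `w V` and `w V*`. Only the conclusion for the first, index `0`, is needed.
  let c : ℝ := (√2)⁻¹
  have hcc : ((c : ℂ) * c) * 2 = 1 := by
    have : c * c * 2 = 1 := by
      simp only [c]
      rw [← mul_inv, Real.mul_self_sqrt (by norm_num)]
      norm_num
    exact_mod_cast this
  let t : M.toStarSubalgebra := (c : ℂ) • 1
  have ht : ∀ y, star t * y * t = ((c : ℂ) * c) • y := fun y => by
    simp only [t, star_smul, star_one, smul_mul_assoc, one_mul, mul_smul_comm, mul_one, smul_smul]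
    simp
  have htu : IsUnit t := by
    have h1 : (c : ℂ) * (2 * c) = 1 := by linear_combination hcc
    refine ⟨⟨t, (2 * (c : ℂ)) • 1, ?_, ?_⟩, rfl⟩
    · simp only [t, smul_mul_smul_comm, mul_one, h1, one_smul]
    · simp only [t, smul_mul_smul_comm, mul_one, mul_comm (2 * (c : ℂ)), h1, one_smul]
  obtain ⟨U, hU, hUx⟩ := hx.2 2 (fun _ => t) ![w * V, w * star V] (fun _ => htu)
    (by
      intro i
      fin_cases i
      · exact hwV V hVu
      · exact hwV _ (Unitary.star_mem hVu))
    (by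
      have := ht 1
      rw [mul_one] at this
      rw [Fin.sum_univ_two, this, ← two_smul ℂ, smul_smul, mul_comm, hcc, one_smul])
    (by
      rw [Fin.sum_univ_two, ht, ht]
      simp only [Matrix.cons_val_zero, Matrix.cons_val_one]
      rw [← smul_add, ← mul_add, hVh, mul_smul_comm, smul_smul, hcc, one_smul, hwh])
    0
  obtain ⟨z, hz⟩ := M.exists_isSplitBy_of_mul_mul_eq_zero hwm
  have hxeq : x = U * w * (V * star U) := by
    calc x = U * (star U * x * U) * star U := by
          simp only [mul_assoc, Unitary.mul_star_self_of_mem hU, mul_one]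
          rw [← mul_assoc, Unitary.mul_star_self_of_mem hU, one_mul]
      _ = _ := by rw [← hUx]; simp [mul_assoc]
  rw [hxeq]
  exact ⟨z, hz.unitary_mul_mul hU (mul_mem hVu (Unitary.star_mem hU))⟩

end VonNeumannAlgebra

/-! ### Isometries and coisometries are C*-extreme. -/

/-- The positive elements `|yᵢ tᵢ - tᵢ x|²` and `tᵢ*(1 - yᵢ* yᵢ)tᵢ`, summed over all `i`, expand to
`1 - x*x - x*x + x*x = 0`, so each of them vanishes. -/
theorem CStarAlgebra.mul_eq_mul_of_isometry_eq_sum {A : Type*} [CStarAlgebra A] {k : ℕ}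
    {t y : Fin k → A} {x : A} (hx : star x * x = 1) (hy : ∀ i, ‖y i‖ ≤ 1)
    (ht : ∑ i, star (t i) * t i = 1) (hxy : x = ∑ i, star (t i) * y i * t i) (i : Fin k) :
    y i * t i = t i * x ∧ star (t i) * (1 - star (y i) * y i) * t i = 0 := by
  let _ := CStarAlgebra.spectralOrder A
  have := CStarAlgebra.spectralOrderedRing A
  have hy' : ∀ i, 0 ≤ 1 - star (y i) * y i := fun i => by
    rw [sub_nonneg, ← CStarAlgebra.norm_le_one_iff_of_nonneg _ (star_mul_self_nonneg (y i)),
      CStarRing.norm_star_mul_self]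
    exact mul_le_one₀ (hy i) (norm_nonneg _) (hy i)
  have h1 : ∀ i, 0 ≤ star (y i * t i - t i * x) * (y i * t i - t i * x) :=
    fun i => star_mul_self_nonneg _
  have h2 : ∀ i, 0 ≤ star (t i) * (1 - star (y i) * y i) * t i :=
    fun i => star_left_conjugate_nonneg (hy' i) _
  have hxs : star x = ∑ i, star (t i) * star (y i) * t i := by
    rw [hxy, star_sum]
    exact Finset.sum_congr rfl fun i _ => by simp only [star_mul, star_star, mul_assoc]
  have hexp : ∀ i, star (y i * t i - t i * x) * (y i * t i - t i * x) +
      star (t i) * (1 - star (y i) * y i) * t i =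
      star (t i) * t i - star (t i) * star (y i) * t i * x - star x * (star (t i) * y i * t i) +
        star x * (star (t i) * t i) * x := fun i => by
    simp only [star_sub, star_mul]
    noncomm_ring
  have hsum : ∑ i, (star (y i * t i - t i * x) * (y i * t i - t i * x) +
      star (t i) * (1 - star (y i) * y i) * t i) = 0 := by
    simp only [hexp, Finset.sum_add_distrib, Finset.sum_sub_distrib, ← Finset.sum_mul,
      ← Finset.mul_sum]
    rw [← hxy, ← hxs, ht, mul_one, hx]
    abel
  have h3 := (Finset.sum_eq_zero_iff_of_nonneg fun i _ => add_nonneg (h1 i) (h2 i)).1 hsum i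
    (Finset.mem_univ i)
  obtain ⟨h4, h5⟩ := (add_eq_zero_iff_of_nonneg (h1 i) (h2 i)).1 h3
  exact ⟨sub_eq_zero.1 ((CStarRing.star_mul_self_eq_zero_iff _).1 h4), h5⟩

namespace VonNeumannAlgebra

attribute [local instance] cstarAlgebra

variable {H : Type u} [NormedAddCommGroup H] [InnerProductSpace ℂ H] [CompleteSpace H]
  (M : VonNeumannAlgebra H)

/-- Polar decomposition of an element with prescribed left and right supports. -/
theorem exists_polar_of_supports {m p q : M.toStarSubalgebra} (hp : IsStarProjection p)
    (hq : IsStarProjection q) (hmp : m * p = m) (hqm : q * m = m)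
    (hinj : ∀ x, m * x = 0 → p * x = 0) (hsurj : ∀ x, x * m = 0 → x * q = 0) :
    ∃ h u, u * h = m ∧ star u * u = p ∧ u * star u = q ∧
      (∀ x, x * h = 0 → x * star u = 0) ∧ ∀ x, Commute x (star m * m) → Commute x h := by
  obtain ⟨h, u, hh, -, huh, hum, hu, hX, hXl, hXr, hc⟩ := M.exists_polar m
  have hps := hp.isSelfAdjoint.star_eq
  have hqs := hq.isSelfAdjoint.star_eq
  refine ⟨h, u, huh, ?_, ?_, hX, hc⟩
  · have h1 : u * (1 - p) = 0 := hXr _ (by rw [mul_sub, mul_one, hmp, sub_self])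
    rw [mul_sub, mul_one, sub_eq_zero] at h1
    have h2 : p * (1 - star u * u) = 0 := hinj _ (by
      have h3 : star m * u = h := by
        rw [← hh, ← hum, star_mul, star_star]
      have h4 : u * (1 - star u * u) = 0 := by rw [mul_sub, mul_one, ← mul_assoc, hu, sub_self]
      rw [← huh, ← h3, mul_assoc, mul_assoc, h4, mul_zero, mul_zero])
    rw [mul_sub, mul_one, sub_eq_zero, ← mul_assoc] at h2
    have h5 := congrArg star h1
    rw [star_mul, hps] at h5
    rw [h2, ← h5]
  · have h1 : (1 - q) * u = 0 := hXl _ (by rw [sub_mul, one_mul, hqm, sub_self])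
    rw [sub_mul, one_mul, sub_eq_zero] at h1
    have h2 : (1 - u * star u) * q = 0 := hsurj _ (by
      rw [sub_mul, one_mul, ← huh, ← mul_assoc, hu, sub_self])
    rw [sub_mul, one_mul, sub_eq_zero] at h2
    have h3 := congrArg star h2
    simp only [star_mul, star_star, hqs] at h3
    rw [h3, ← mul_assoc, ← h1]

/-! ### Wold decomposition and similarity of isometries. -/

section Wold

variable {M} {x y t : M.toStarSubalgebra}

theorem isStarProjection_one_sub_mul_star (hx : star x * x = 1) :
    IsStarProjection (1 - x * star x) := by
  refine IsStarProjection.one_sub (isStarProjection_iff'.2 ⟨?_, by rw [star_mul, star_star]⟩)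
  rw [mul_assoc, ← mul_assoc (star x), hx, one_mul]

/-- Similar isometries have equivalent defect projections. -/
theorem exists_defect_equiv (hx : star x * x = 1) (hy : star y * y = 1) (ht : IsUnit t)
    (hyt : y * t = t * x) :
    ∃ v, star v * v = 1 - x * star x ∧ v * star v = 1 - y * star y := by
  obtain ⟨⟨t, r, htr, hrt⟩, rfl⟩ := ht
  change y * t = t * x at hyt
  have hyf : star y * (1 - y * star y) = 0 := by
    rw [mul_sub, mul_one, ← mul_assoc, hy, one_mul, sub_self]
  have hxe : star x * (1 - x * star x) = 0 := by
    rw [mul_sub, mul_one, ← mul_assoc, hx, one_mul, sub_self]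
  have hr : star t * star r = 1 := by rw [← star_mul, hrt, star_one]
  have hr' : star r * star t = 1 := by rw [← star_mul, htr, star_one]
  have hxr : x * r = r * y := by
    calc x * r = r * t * x * r := by rw [hrt, one_mul]
      _ = r * y * (t * r) := by rw [mul_assoc r, ← hyt]; simp only [mul_assoc]
      _ = r * y := by rw [htr, mul_one]
  have hyts : star x * star t = star t * star y := by rw [← star_mul, ← star_mul, hyt]
  have hxrs : star y * star r = star r * star x := by rw [← star_mul, ← star_mul, hxr]
  have hf := isStarProjection_one_sub_mul_star hy
  -- Taking adjoints in `y t = t x`, `star t` maps the kernel of `star y` onto the kernel of `star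
  -- x`, with inverse `star r`. These kernels are the ranges of the defect projections, so the polar
  -- part of the restriction gives the equivalence.
  obtain ⟨h, u, -, h1, h2, -⟩ := M.exists_polar_of_supports (m := star t * (1 - y * star y)) hf
    (isStarProjection_one_sub_mul_star hx) (by rw [mul_assoc, hf.isIdempotentElem.eq])
    (by rw [sub_mul, one_mul, mul_assoc x, ← mul_assoc (star x), hyts, mul_assoc (star t), hyf,
          mul_zero, mul_zero, sub_zero])
    (fun X hX => by
      have := congrArg (star r * ·) hX
      simpa only [mul_zero, ← mul_assoc, hr', one_mul] using this)
    (fun X hX => by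
      have h0 : 1 - x * star x = star t * (1 - y * star y) * (star r * (1 - x * star x)) := by
        rw [mul_assoc, sub_mul, one_mul, mul_assoc y, ← mul_assoc (star y), hxrs,
          mul_assoc (star r), hxe, mul_zero, mul_zero, sub_zero, ← mul_assoc, hr, one_mul]
      rw [h0, ← mul_assoc, hX, zero_mul])
  exact ⟨star u, by rw [star_star, h2], by rw [star_star, h1]⟩

/-- The partial isometry that intertwines the shift parts of two isometries. -/
theorem exists_shift_intertwiner {v : M.toStarSubalgebra} (hx : star x * x = 1)
    (hy : star y * y = 1) (hv : star v * v = 1 - x * star x) (hv' : v * star v = 1 - y * star y) :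
    ∃ s, s * star s * s = s ∧ s = v + y * s * star x ∧
      (∀ g, (∀ a, g * a = 0 → g * (v + y * a * star x) = 0) → g * s = 0) ∧
      (∀ g, (∀ a, a * g = 0 → (v + y * a * star x) * g = 0) → s * g = 0) ∧
      v * x = 0 ∧ star y * v = 0 := by
  have hvx : v * x = 0 := by
    refine M.star_mul_self_eq_zero ?_
    rw [star_mul, mul_assoc, ← mul_assoc (star v), hv, sub_mul, one_mul, mul_assoc, hx, mul_one,
      sub_self, mul_zero]
  have hyv : star y * v = 0 := by
    have : star v * y = 0 := by
      refine M.star_mul_self_eq_zero ?_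
      rw [star_mul, star_star, mul_assoc, ← mul_assoc v, hv', sub_mul, one_mul, mul_assoc, hy,
        mul_one, sub_self, mul_zero]
    simpa only [star_mul, star_star, star_zero] using congrArg star this
  have hxv : star x * star v = 0 := by rw [← star_mul, hvx, star_zero]
  have hvy : star v * y = 0 := by simpa using congrArg star hyv
  have hvv : v * star v * v = v := by
    rw [mul_assoc, hv, mul_sub, mul_one, ← mul_assoc, hvx, zero_mul, sub_zero]
  let F : M.toStarSubalgebra → M.toStarSubalgebra := fun a => v + y * a * star x
  have hF1 : ∀ a b, star (F a) * F b = star v * v + x * (star a * b) * star x := fun a b => by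
    calc star (F a) * F b = star v * v + (star v * y) * b * star x + x * star a * (star y * v) +
          x * star a * (star y * y) * b * star x := by
            simp only [F, star_add, star_mul, star_star]; noncomm_ring
      _ = _ := by rw [hvy, hyv, hy]; noncomm_ring
  have hF2 : ∀ a b, F a * star (F b) = v * star v + y * (a * star b) * star y := fun a b => by
    calc F a * star (F b) = v * star v + (v * x) * star b * star y + y * a * (star x * star v) +
          y * a * (star x * x) * star b * star y := by
            simp only [F, star_add, star_mul, star_star]; noncomm_ring
      _ = _ := by rw [hvx, hxv, hx]; noncomm_ring
  have hFp : ∀ a, a * star a * a = a → F a * star (F a) * F a = F a := fun a ha => by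
    calc F a * star (F a) * F a = v * star v * v + v * (star v * y) * a * star x +
          y * a * star a * (star y * v) + y * (a * star a) * (star y * y) * a * star x := by
            rw [hF2]; simp only [F]; noncomm_ring
      _ = v + y * (a * star a * a) * star x := by rw [hvy, hyv, hy, hvv]; noncomm_ring
      _ = F a := by rw [ha]
  have hFe : ∀ a b, StarExtends a b → StarExtends (F a) (F b) := fun a b h =>
    ⟨by rw [hF1, hF1, h.1], by rw [hF2, hF2, h.2]⟩
  -- `c n` is the sum of `y^k v (x*)^k` over `k < n`; these partial isometries extend one another,
  -- and their limit carries the shift part of `x` to that of `y`.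
  let c : ℕ → M.toStarSubalgebra := fun n => F^[n] 0
  have hc : ∀ n, c (n + 1) = F (c n) := fun n => Function.iterate_succ_apply' F n 0
  have hcp : ∀ n, c n * star (c n) * c n = c n := by
    intro n
    induction n with
    | zero => simp [c]
    | succ n ih => rw [hc]; exact hFp _ ih
  have hce : ∀ n, StarExtends (c n) (c (n + 1)) := by
    intro n
    induction n with
    | zero => exact ⟨by simp [c], by simp [c]⟩
    | succ n ih => rw [hc, hc (n + 1)]; exact hFe _ _ ih
  have hcm : ∀ n m, n ≤ m → StarExtends (c n) (c m) := by
    intro n m h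
    induction m, h using Nat.le_induction with
    | base => exact ⟨rfl, rfl⟩
    | succ m _ ih => exact ih.trans (hcp n) (hce m)
  obtain ⟨s, hs, hsc, hX1, hX2⟩ := M.exists_sup_of_isChain_starExtends (C := Set.range c)
    (Set.range_nonempty c) (by rintro _ ⟨n, rfl⟩; exact hcp n)
    (by
      rintro _ ⟨n, rfl⟩ _ ⟨m, rfl⟩
      exact (le_total n m).imp (hcm n m) (hcm m n))
  simp only [Set.forall_mem_range] at hsc hX1 hX2
  have hcs : ∀ n, c n * (star s * s) = c n := fun n => by
    have h1 := congrArg star (hsc n).2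
    simp only [star_mul, star_star] at h1
    rw [← mul_assoc, h1, mul_assoc, (hsc n).1, ← mul_assoc, hcp]
  have hc1 : c 1 = v := by rw [hc 0]; simp [F, c]
  -- The fixed-point equation is obtained without continuity of `F`: `F s` vanishes off the initial
  -- projection of `s`, and it agrees with `s` on it by `hsF`.
  have hker : F s * (1 - star s * s) = 0 := by
    have h1 : s * (star x * (1 - star s * s)) = 0 := hX2 _ fun n => by
      have h2 : c n * star x = star y * (c (n + 1) - c 1) := by
        rw [hc1, hc, add_sub_cancel_left, ← mul_assoc, ← mul_assoc, hy, one_mul]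
      rw [← mul_assoc, h2, mul_assoc, mul_sub, mul_one, sub_mul, hcs, hcs, sub_self, mul_zero]
    have h3 : v * (1 - star s * s) = 0 := by
      rw [← hc1, mul_sub, mul_one, hcs, sub_self]
    rw [add_mul, h3, zero_add, mul_assoc, mul_assoc, h1, mul_zero]
  have hsF : (s - F s) * star s = 0 := by
    have h1 : s * star (s - F s) = 0 := hX2 _ fun n => by
      have h2 : (s - F s) * star (c n) = 0 := by
        cases n with
        | zero => simp [c]
        | succ n => rw [sub_mul, (hsc (n + 1)).2, hc, hF2, hF2, (hsc n).2, sub_self]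
      simpa only [star_mul, star_star, star_zero] using congrArg star h2
    simpa only [star_mul, star_star, star_zero] using congrArg star h1
  have hfix : s = F s := by
    rw [sub_mul, sub_eq_zero] at hsF
    rw [mul_sub, mul_one, sub_eq_zero, ← mul_assoc, ← hsF, hs] at hker
    exact hker.symm
  refine ⟨s, hs, hfix, fun g hg => hX1 g fun n => ?_, fun g hg => hX2 g fun n => ?_, hvx, hyv⟩
  · induction n with
    | zero => simp [c]
    | succ n ih => rw [hc]; exact hg _ ih
  · induction n with
    | zero => simp [c]
    | succ n ih => rw [hc]; exact hg _ ih

theorem mul_star_mul_self_eq {u p : M.toStarSubalgebra} (hp : IsStarProjection p)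
    (hu : star u * u = p) : u * p = u := by
  have h1 : u * (1 - p) = 0 := M.star_mul_self_eq_zero (by
    rw [star_mul, mul_assoc, ← mul_assoc (star u), hu, mul_sub, mul_one,
      hp.isIdempotentElem.eq, sub_self, mul_zero])
  rw [mul_sub, mul_one, sub_eq_zero] at h1
  exact h1.symm

/-- The polar part of an intertwiner between the unitary parts of two isometries. -/
theorem exists_unitaryPart_intertwiner {m p q : M.toStarSubalgebra} (hy : star y * y = 1)
    (hym : y * m = m * x) (hpp : IsStarProjection p) (hqq : IsStarProjection q)
    (hpx' : p * x = x * p) (hxxp : x * star x * p = p) (hmp : m * p = m) (hqm : q * m = m)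
    (hinj : ∀ g, m * g = 0 → p * g = 0) (hsurj : ∀ g, g * m = 0 → g * q = 0) :
    ∃ u, star u * u = p ∧ u * star u = q ∧ y * u = u * x := by
  obtain ⟨h, u, huh, hu1, hu2, hX, hc⟩ := M.exists_polar_of_supports hpp hqq hmp hqm hinj hsurj
  have hpm : p * star m = star m := by
    rw [← hpp.isSelfAdjoint.star_eq, ← star_mul, hmp]
  -- Since `y` is isometric, `m*m = x* m*m x`, and `x x*` fixes `m*m`, whose range lies under `p`.
  -- Hence `x` commutes with `m*m` and with its square root `h`.
  have hxh : Commute x h := hc x (by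
    have h1 : star m * m = star x * (star m * m) * x := by
      calc star m * m = star m * (star y * y) * m := by
            rw [hy, mul_one]
        _ = star (y * m) * (y * m) := by simp only [star_mul, mul_assoc]
        _ = _ := by rw [hym]; simp only [star_mul, mul_assoc]
    have h2 : x * star x * (star m * m) = star m * m := by
      rw [← hpm, ← mul_assoc, ← mul_assoc, hxxp]
    change x * _ = _ * x
    conv_lhs => rw [h1]
    rw [← mul_assoc, ← mul_assoc, h2])
  have hup : u * p = u := mul_star_mul_self_eq hpp hu1
  have h1 : (y * u - u * x) * star u = 0 := hX _ (by
    rw [sub_mul, mul_assoc, huh, mul_assoc, hxh.eq, ← mul_assoc u, huh, hym, sub_self])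
  have h2 : (y * u - u * x) * p = 0 := by rw [← hu1, ← mul_assoc, h1, zero_mul]
  rw [sub_mul, mul_assoc, hup, mul_assoc, ← hpx', ← mul_assoc, hup, sub_eq_zero] at h2
  exact ⟨u, hu1, hu2, h2⟩

/-- Similar isometries are unitarily equivalent. -/
theorem exists_unitary_of_similar_isometries (hx : star x * x = 1) (hy : star y * y = 1)
    (ht : IsUnit t) (hyt : y * t = t * x) :
    ∃ w ∈ unitary M.toStarSubalgebra, y = star w * x * w := by
  obtain ⟨v, hv, hv'⟩ := exists_defect_equiv hx hy ht hyt
  obtain ⟨s, hs, hsF, hg1, hg2, hvx, hyv⟩ := exists_shift_intertwiner hx hy hv hv'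
  obtain ⟨⟨t, r, htr, hrt⟩, rfl⟩ := ht
  change y * t = t * x at hyt
  have hxr : x * r = r * y := by
    calc x * r = r * t * x * r := by rw [hrt, one_mul]
      _ = r * y * (t * r) := by rw [mul_assoc r, ← hyt]; simp only [mul_assoc]
      _ = r * y := by rw [htr, mul_one]
  have hyts : star x * star t = star t * star y := by rw [← star_mul, ← star_mul, hyt]
  have hss := star_mul_self_mul_star hs
  have hvx' : star x * star v = 0 := by rw [← star_mul, hvx, star_zero]
  have hyv' : star v * y = 0 := by simpa using congrArg star hyv
  -- The complements `p` and `q` of the initial and final projections of `s` are the unitary parts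
  -- of `x` and `y`: below, `p = x p x*` and `q = y q y*`.
  obtain ⟨p, hp⟩ : ∃ p, p = 1 - star s * s := ⟨_, rfl⟩
  obtain ⟨q, hq⟩ : ∃ q, q = 1 - s * star s := ⟨_, rfl⟩
  have hpp : IsStarProjection p := hp ▸ (isStarProjection_star_mul_self hs).one_sub
  have hqq : IsStarProjection q := by
    have := isStarProjection_star_mul_self (u := star s) (by rw [star_star, hss])
    rw [star_star] at this
    exact hq ▸ this.one_sub
  have hsp : s * p = 0 := by rw [hp, mul_sub, mul_one, ← mul_assoc, hs, sub_self]
  have hsq : star s * q = 0 := by rw [hq, mul_sub, mul_one, ← mul_assoc, hss, sub_self]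
  have hpx : p = x * p * star x := by
    have h1 : star s * s = star v * v + x * (star s * s) * star x := by
      conv_lhs => rw [hsF]
      calc _ = star v * v + (star v * y) * s * star x + x * star s * (star y * v) +
            x * star s * (star y * y) * s * star x := by
              simp only [star_add, star_mul, star_star]; noncomm_ring
        _ = _ := by rw [hyv', hyv, hy]; noncomm_ring
    rw [hv] at h1
    rw [hp]
    conv_lhs => rw [h1]
    noncomm_ring
  have hqy : q = y * q * star y := by
    have h1 : s * star s = v * star v + y * (s * star s) * star y := by
      conv_lhs => rw [hsF]
      calc _ = v * star v + (v * x) * star s * star y + y * s * (star x * star v) +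
            y * s * (star x * x) * star s * star y := by
              simp only [star_add, star_mul, star_star]; noncomm_ring
        _ = _ := by rw [hvx', hvx, hx]; noncomm_ring
    rw [hv'] at h1
    rw [hq]
    conv_lhs => rw [h1]
    noncomm_ring
  have hpx' : p * x = x * p := by
    conv_lhs => rw [hpx, mul_assoc, hx, mul_one]
  have hxxp : x * star x * p = p := by
    conv_lhs => rw [hpx, ← mul_assoc, ← mul_assoc, mul_assoc x, hx, mul_one]
    exact hpx.symm
  -- Taken adjointly, `t` maps the unitary part `p` into `q`; `hsrq` says that its inverse `r` maps
  -- `q` into `p`. So `t * p` is a bijection between the two unitary parts.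
  have hpts : p * star t * s = 0 := hg1 _ fun a ha => by
    rw [hpx]
    calc x * p * star x * star t * (v + y * a * star x)
        = x * p * (star x * star t) * (v + y * a * star x) := by simp only [mul_assoc]
      _ = x * p * star t * (star y * v) + x * (p * star t * ((star y * y) * a)) * star x := by
          rw [hyts]; noncomm_ring
      _ = 0 := by rw [hyv, hy, one_mul, ha]; noncomm_ring
  have hstp : star s * t * p = 0 := by
    have := congrArg star hpts
    simpa only [star_mul, star_star, star_zero, hpp.isSelfAdjoint.star_eq, mul_assoc] using this
  have hsrq : s * (r * q) = 0 := hg2 _ fun a ha => by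
    rw [hqy]
    calc (v + y * a * star x) * (r * (y * q * star y))
        = (v + y * a * star x) * (r * y) * q * star y := by simp only [mul_assoc]
      _ = (v * x) * r * q * star y + y * (a * (star x * x) * (r * q)) * star y := by
          rw [← hxr]; noncomm_ring
      _ = 0 := by rw [hvx, hx, mul_one, ha]; noncomm_ring
  have hym : y * (t * p) = t * p * x := by
    rw [← mul_assoc, hyt, mul_assoc, mul_assoc, hpx']
  obtain ⟨u, hu1, hu2, hyu⟩ := exists_unitaryPart_intertwiner hy hym hpp hqq hpx' hxxp
    (by rw [mul_assoc, hpp.isIdempotentElem.eq])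
    (by rw [hq, sub_mul, one_mul, mul_assoc s, ← mul_assoc (star s), hstp, mul_zero, sub_zero])
    (fun X hX => by
      have := congrArg (r * ·) hX
      simpa only [mul_zero, ← mul_assoc, hrt, one_mul] using this)
    (fun X hX => by
      have h0 : q = t * p * (r * q) := by
        rw [hp, mul_assoc, sub_mul, one_mul, mul_assoc (star s), hsrq, mul_zero, sub_zero,
          ← mul_assoc, htr, one_mul]
      rw [h0, ← mul_assoc, hX, zero_mul])
  have hup : u * p = u := mul_star_mul_self_eq hpp hu1
  have hqu : q * u = u := by rw [← hu2, mul_assoc, hu1, hup]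
  have hsu : star s * u = 0 := by rw [← hqu, ← mul_assoc, hsq, zero_mul]
  have hsu' : s * star u = 0 := by
    rw [← hup, star_mul, hpp.isSelfAdjoint.star_eq, ← mul_assoc, hsp, zero_mul]
  have hus : star u * s = 0 := by simpa using congrArg star hsu
  have hus' : u * star s = 0 := by simpa using congrArg star hsu'
  have hw1 : star (s + u) * (s + u) = 1 := by
    rw [star_add, add_mul, mul_add, mul_add, hsu, hus, hu1, hp]; abel
  have hw2 : (s + u) * star (s + u) = 1 := by
    rw [star_add, add_mul, mul_add, mul_add, hsu', hus', hu2, hq]; abel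
  have hwx : (s + u) * x = y * (s + u) := by
    have h1 : s * x = y * s := by
      conv_lhs => rw [hsF, add_mul, hvx, zero_add, mul_assoc, hx, mul_one]
    rw [add_mul, h1, ← hyu, mul_add]
  refine ⟨star (s + u), ?_, ?_⟩
  · exact Unitary.mem_iff.2 ⟨by rw [star_star, hw2], by rw [star_star, hw1]⟩
  · rw [star_star, hwx, mul_assoc, hw2, mul_one]

end Wold

variable {M}

theorem isCStarExtremePoint_of_isometry {x : M.toStarSubalgebra} (hx : star x * x = 1) :
    IsCStarExtremePoint x := by
  refine ⟨mem_closedBall_zero_iff.2 (norm_le_one_of_star_mul_self hx), ?_⟩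
  intro k t y ht hy htt hxy i
  obtain ⟨h1, h2⟩ := CStarAlgebra.mul_eq_mul_of_isometry_eq_sum hx
    (fun i => mem_closedBall_zero_iff.1 (hy i)) htt hxy i
  have h3 : 1 - star (y i) * y i = 0 := by
    have := (ht i).mul_left_eq_zero.1 h2
    exact (ht i).star.mul_right_eq_zero.1 this
  exact exists_unitary_of_similar_isometries hx (sub_eq_zero.1 h3).symm (ht i) h1

/-- Taking adjoints turns a combination of `star x` into one of `x` with the same coefficients and
the adjoint points. -/
theorem _root_.isCStarExtremePoint_star {x : M.toStarSubalgebra} (hx : IsCStarExtremePoint x) :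
    IsCStarExtremePoint (star x) := by
  refine ⟨mem_closedBall_zero_iff.2 ?_, fun k t y ht hy htt hxy i => ?_⟩
  · rw [norm_star]
    exact mem_closedBall_zero_iff.1 hx.1
  · obtain ⟨w, hw, h⟩ := hx.2 k t (fun i => Star.star (y i)) ht
      (fun i => mem_closedBall_zero_iff.2 (by
        rw [norm_star]; exact mem_closedBall_zero_iff.1 (hy i))) htt
      (by
        rw [← star_star x, hxy, star_sum]
        exact Finset.sum_congr rfl fun i _ => by simp only [star_mul, star_star, mul_assoc]) i
    refine ⟨w, hw, ?_⟩
    have := congrArg Star.star h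
    simpa only [star_mul, star_star, mul_assoc] using this

theorem isCStarExtremePoint_of_coisometry {x : M.toStarSubalgebra} (hx : x * star x = 1) :
    IsCStarExtremePoint x := by
  have := isCStarExtremePoint_star (isCStarExtremePoint_of_isometry (x := Star.star x) (by rwa [star_star]))
  rwa [star_star] at this

end VonNeumannAlgebra

/-! ### Infinite projections and the central splitting condition. -/

section Ring

variable {A B : Type*} [Ring A] [StarRing A] [Ring B] [StarRing B]

/-- The implementing partial isometry may be taken to have the right supports. -/
theorem MvNEquiv.exists_mul_eq {p q : A} (hp : IsStarProjection p) (hq : IsStarProjection q)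
    (h : MvNEquiv p q) : ∃ v : A, star v * v = p ∧ v * star v = q ∧ v * p = v ∧ q * v = v := by
  obtain ⟨v, hv, hv'⟩ := h
  obtain ⟨hp2, hps⟩ := isStarProjection_iff'.1 hp
  obtain ⟨hq2, hqs⟩ := isStarProjection_iff'.1 hq
  refine ⟨q * v * p, ?_, ?_, by rw [mul_assoc, hp2], by rw [← mul_assoc, ← mul_assoc, hq2]⟩
  · calc star (q * v * p) * (q * v * p) = p * star v * (q * q) * v * p := by
          simp only [star_mul, hps, hqs, mul_assoc]
      _ = p * (star v * v) * (star v * v) * p := by rw [hq2, ← hv']; simp only [mul_assoc]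
      _ = p := by rw [hv, hp2, hp2, hp2]
  · calc q * v * p * star (q * v * p) = q * v * (p * p) * star v * q := by
          simp only [star_mul, hps, hqs, mul_assoc]
      _ = q * (v * star v) * (v * star v) * q := by rw [hp2, ← hv]; simp only [mul_assoc]
      _ = q := by rw [hv', hq2, hq2, hq2]

/-- Adding `r - p` to the partial isometry that makes `p` infinite gives one from `r` onto the
proper subprojection `q + (r - p)`. -/
theorem IsInfiniteProjection.of_le {p r : A} (hp : IsInfiniteProjection p)
    (hr : IsStarProjection r) (hrp : r * p = p) : IsInfiniteProjection r := by
  obtain ⟨hpp, q, hq, hpq, hne, hv⟩ := hp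
  obtain ⟨v, hv, hv', hvp, hqv⟩ := hv.exists_mul_eq hpp hq
  obtain ⟨hp2, hps⟩ := isStarProjection_iff'.1 hpp
  obtain ⟨hr2, hrs⟩ := isStarProjection_iff'.1 hr
  obtain ⟨hq2, hqs⟩ := isStarProjection_iff'.1 hq
  have hpr : p * r = p := by
    have := congrArg star hrp
    rwa [star_mul, hps, hrs] at this
  have hrq : r * q = q := by rw [← hpq, ← mul_assoc, hrp]
  have h1 : (r - p) * q = 0 := by rw [sub_mul, hrq, hpq, sub_self]
  have h2 : q * (r - p) = 0 := by
    have := congrArg star h1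
    rwa [star_mul, star_sub, hps, hrs, hqs, star_zero] at this
  have h3 : (r - p) * v = 0 := by rw [← hqv, ← mul_assoc, h1, zero_mul]
  have h4 : v * (r - p) = 0 := by
    rw [← hvp, mul_assoc, mul_sub, hpr, hp2, sub_self, mul_zero]
  have hd : star (r - p) = r - p := by rw [star_sub, hrs, hps]
  have hdd : (r - p) * (r - p) = r - p := by
    rw [mul_sub, sub_mul, sub_mul, hr2, hpr, hrp, hp2, sub_self, sub_zero]
  have h3' : star v * (r - p) = 0 := by
    have := congrArg star h3
    rwa [star_mul, hd, star_zero] at this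
  have h4' : (r - p) * star v = 0 := by
    have := congrArg star h4
    rwa [star_mul, hd, star_zero] at this
  refine ⟨hr, q + (r - p), isStarProjection_iff'.2 ⟨?_, ?_⟩, ?_, ?_, v + (r - p), ?_, ?_⟩
  · rw [add_mul, mul_add, mul_add, h1, h2, hq2, hdd, add_zero, zero_add]
  · rw [star_add, hqs, hd]
  · rw [mul_add, mul_sub, hrq, hr2, hrp]
  · intro h
    refine hne ?_
    calc q = q + (r - p) - r + p := by abel
      _ = p := by rw [h]; abel
  · rw [star_add, hd, add_mul, mul_add, mul_add, h3, h3', hv, hdd, add_zero, zero_add]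
    abel
  · rw [star_add, hd, add_mul, mul_add, mul_add, h4, h4', hv', hdd, add_zero, zero_add]

theorem not_isInfiniteProjection_zero : ¬ IsInfiniteProjection (0 : A) := by
  rintro ⟨-, q, -, h, hne, -⟩
  rw [zero_mul] at h
  exact hne h.symm

theorem IsInfiniteProjection.map_equiv {p : A} (hp : IsInfiniteProjection p) (e : A ≃⋆+* B) :
    IsInfiniteProjection (e p) := by
  obtain ⟨hpp, q, hq, hpq, hne, v, hv, hv'⟩ := hp
  exact ⟨hpp.map e, e q, hq.map e, by rw [← map_mul, hpq], fun h => hne (e.injective h), e v,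
    by rw [← map_star, ← map_mul, hv], by rw [← map_star, ← map_mul, hv']⟩

theorem isInfiniteProjection_prod_left {p : A} :
    IsInfiniteProjection ((p, 0) : A × B) ↔ IsInfiniteProjection p := by
  constructor
  · rintro ⟨hpp, ⟨q, q'⟩, hq, hpq, hne, ⟨v, v'⟩, hv, hv'⟩
    simp only [isStarProjection_iff', Prod.mk_mul_mk, Prod.star_def, Prod.mk.injEq] at *
    refine ⟨isStarProjection_iff'.2 ⟨hpp.1.1, hpp.2.1⟩, q,
      isStarProjection_iff'.2 ⟨hq.1.1, hq.2.1⟩, hpq.1, fun h => hne ?_, v, hv.1, hv'.1⟩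
    rw [h, ← hpq.2, zero_mul]
  · rintro ⟨hpp, q, hq, hpq, hne, v, hv, hv'⟩
    obtain ⟨hp2, hps⟩ := isStarProjection_iff'.1 hpp
    obtain ⟨hq2, hqs⟩ := isStarProjection_iff'.1 hq
    refine ⟨isStarProjection_iff'.2 ?_, (q, 0), isStarProjection_iff'.2 ?_, ?_, ?_, (v, 0), ?_, ?_⟩
    all_goals simp_all [Prod.star_def]

theorem isInfiniteProjection_prod_right {p : B} :
    IsInfiniteProjection ((0, p) : A × B) ↔ IsInfiniteProjection p := by
  constructor
  · rintro ⟨hpp, ⟨q', q⟩, hq, hpq, hne, ⟨v', v⟩, hv, hv'⟩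
    simp only [isStarProjection_iff', Prod.mk_mul_mk, Prod.star_def, Prod.mk.injEq] at *
    refine ⟨isStarProjection_iff'.2 ⟨hpp.1.2, hpp.2.2⟩, q,
      isStarProjection_iff'.2 ⟨hq.1.2, hq.2.2⟩, hpq.2, fun h => hne ?_, v, hv.2, hv'.2⟩
    rw [h, ← hpq.1, zero_mul]
  · rintro ⟨hpp, q, hq, hpq, hne, v, hv, hv'⟩
    obtain ⟨hp2, hps⟩ := isStarProjection_iff'.1 hpp
    obtain ⟨hq2, hqs⟩ := isStarProjection_iff'.1 hq
    refine ⟨isStarProjection_iff'.2 ?_, (0, q), isStarProjection_iff'.2 ?_, ?_, ?_, (0, v), ?_, ?_⟩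
    all_goals simp_all [Prod.star_def]

/-- Every central projection or its complement is finite. -/
def HasFiniteCentralSplittings (A : Type*) [Ring A] [StarRing A] : Prop :=
  ∀ z : A, IsStarProjection z → z ∈ Set.center A →
    ¬ IsInfiniteProjection z ∨ ¬ IsInfiniteProjection (1 - z)

theorem hasFiniteCentralSplittings_of_finite (h : ¬ IsInfiniteProjection (1 : A)) :
    HasFiniteCentralSplittings A := fun z _ _ =>
  Or.inl fun hz => h (hz.of_le (IsStarProjection.one A) (one_mul z))

theorem hasFiniteCentralSplittings_of_trivial
    (h : ∀ z : A, IsStarProjection z → z ∈ Set.center A → z = 0 ∨ z = 1) :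
    HasFiniteCentralSplittings A := fun z hz hzc => by
  rcases h z hz hzc with rfl | rfl
  · exact Or.inl not_isInfiniteProjection_zero
  · rw [sub_self]
    exact Or.inr not_isInfiniteProjection_zero

theorem HasFiniteCentralSplittings.of_equiv (h : HasFiniteCentralSplittings B) (e : A ≃⋆+* B) :
    HasFiniteCentralSplittings A := fun z hz hzc => by
  have hc : e z ∈ Set.center B := by
    rw [Semigroup.mem_center_iff] at hzc ⊢
    intro g
    obtain ⟨a, rfl⟩ := EquivLike.surjective e g
    rw [← map_mul, hzc, map_mul]
  refine (h (e z) (hz.map e) hc).imp (fun h hi => h (hi.map_equiv e)) fun h hi => h ?_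
  have := hi.map_equiv e
  rwa [map_sub, map_one] at this

/-- The second coordinate of a central projection is `0` or `1`, so the projection or its complement
lies in the finite first summand. -/
theorem hasFiniteCentralSplittings_prod (hA : ¬ IsInfiniteProjection (1 : A))
    (hB : ∀ z : B, IsStarProjection z → z ∈ Set.center B → z = 0 ∨ z = 1) :
    HasFiniteCentralSplittings (A × B) := by
  rintro ⟨z, z'⟩ hz hzc
  have hz1 : IsStarProjection z := isStarProjection_iff'.2
    ⟨congrArg Prod.fst hz.isIdempotentElem, congrArg Prod.fst hz.isSelfAdjoint⟩
  have hz2 : IsStarProjection z' := isStarProjection_iff'.2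
    ⟨congrArg Prod.snd hz.isIdempotentElem, congrArg Prod.snd hz.isSelfAdjoint⟩
  have hzc2 : z' ∈ Set.center B := by
    rw [Semigroup.mem_center_iff] at hzc ⊢
    exact fun g => congrArg Prod.snd (hzc (0, g))
  have key : ∀ z : A, ¬ IsInfiniteProjection ((z, 0) : A × B) := fun z hz =>
    hA ((isInfiniteProjection_prod_left.1 hz).of_le (IsStarProjection.one A) (one_mul z))
  rcases hB z' hz2 hzc2 with rfl | rfl
  · exact Or.inl (key z)
  · refine Or.inr ?_
    have : (1 : A × B) - (z, 1) = (1 - z, 0) := by ext <;> simp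
    rw [this]
    exact key _

/-- A coisometry on a finite central summand is unitary there: `star y * z` makes `z` equivalent to
its subprojection `z * (star y * y)`. -/
theorem star_mul_self_eq_of_finite {z y : A} (hz : IsStarProjection z) (hzc : z ∈ Set.center A)
    (hfin : ¬ IsInfiniteProjection z) (h : z * (y * star y) = z) : z * (star y * y) = z := by
  obtain ⟨hz2, hzs⟩ := isStarProjection_iff'.1 hz
  have hc := Semigroup.mem_center_iff.1 hzc
  have h1 : star (star y * z) * (star y * z) = z := by
    calc star (star y * z) * (star y * z) = z * (y * star y) * z := by
          simp only [star_mul, star_star, hzs, mul_assoc]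
      _ = z := by rw [h, hz2]
  have h2 : star y * z * star (star y * z) = z * (star y * y) := by
    calc star y * z * star (star y * z) = star y * (z * z) * y := by
          simp only [star_mul, star_star, hzs, mul_assoc]
      _ = z * (star y * y) := by rw [hz2, hc (star y), mul_assoc]
  by_contra hne
  refine hfin ⟨hz, _, isStarProjection_iff'.2 ⟨?_, ?_⟩, ?_, hne, star y * z, h1, h2⟩
  · calc z * (star y * y) * (z * (star y * y)) = z * star y * (y * z) * star y * y := by
          simp only [mul_assoc]
      _ = z * star y * (z * (y * star y)) * y := by rw [hc y]; simp only [mul_assoc]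
      _ = z * (star y * z) * y := by rw [h, mul_assoc z]
      _ = z * (star y * y) := by rw [hc (star y), ← mul_assoc, hz2, mul_assoc]
  · rw [star_mul, star_mul, star_star, hzs, hc]
  · rw [← mul_assoc, hz2]

end Ring

/-! ### Extreme points under the splitting condition; factors; the greatest finite central
projection. -/

namespace VonNeumannAlgebra

attribute [local instance] cstarAlgebra

variable {H : Type u} [NormedAddCommGroup H] [InnerProductSpace ℂ H] [CompleteSpace H]
  {M : VonNeumannAlgebra H}

theorem setOf_isCStarExtremePoint_of_hasFiniteCentralSplittings
    (hM : HasFiniteCentralSplittings M.toStarSubalgebra) :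
    {x : M.toStarSubalgebra | IsCStarExtremePoint x} =
      {x : M.toStarSubalgebra | star x * x = 1} ∪ {x : M.toStarSubalgebra | x * star x = 1} := by
  refine Set.Subset.antisymm (fun x hx => ?_) ?_
  · obtain ⟨z, hz, hzc, h1, h2⟩ := M.exists_isSplitBy_of_isCStarExtremePoint hx
    have hzc' : 1 - z ∈ Set.center M.toStarSubalgebra := by
      rw [Semigroup.mem_center_iff] at hzc ⊢
      intro g
      rw [mul_sub, sub_mul, hzc, mul_one, one_mul]
    have hsplit : ∀ a : M.toStarSubalgebra, z * a = z → (1 - z) * a = 1 - z → a = 1 := by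
      intro a h h'
      calc a = z * a + (1 - z) * a := by rw [← add_mul]; simp
        _ = 1 := by rw [h, h']; simp
    rcases hM z hz hzc with h | h
    · exact Or.inl (hsplit _ (star_mul_self_eq_of_finite hz hzc h h1) h2)
    · refine Or.inr (hsplit _ h1 ?_)
      have := star_mul_self_eq_of_finite (y := star x) hz.one_sub hzc' h (by rwa [star_star])
      rwa [star_star] at this
  · rintro x (hx | hx)
    · exact isCStarExtremePoint_of_isometry hx
    · exact isCStarExtremePoint_of_coisometry hx

theorem IsFactor.eq_zero_or_eq_one (hM : M.IsFactor) (z : M.toStarSubalgebra)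
    (hz : IsStarProjection z) (hzc : z ∈ Set.center M.toStarSubalgebra) : z = 0 ∨ z = 1 := by
  have h : z ∈ Subalgebra.center ℂ M.toStarSubalgebra := by
    rw [← SetLike.mem_coe, Subalgebra.coe_center]
    exact hzc
  rw [hM, Algebra.mem_bot] at h
  obtain ⟨c, rfl⟩ := h
  have h1 := hz.isIdempotentElem.eq
  rw [← map_mul, ← sub_eq_zero, ← map_sub, Algebra.algebraMap_eq_smul_one, smul_eq_zero] at h1
  rcases h1 with h1 | h1
  · have h2 : c * (c - 1) = 0 := by linear_combination h1
    rcases mul_eq_zero.1 h2 with h3 | h3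
    · exact Or.inl (by rw [h3, map_zero])
    · exact Or.inr (by rw [sub_eq_zero.1 h3, map_one])
  · exact Or.inl (by rw [Algebra.algebraMap_eq_smul_one, h1, smul_zero])

/-- An algebra with no nontrivial central projection is a factor. -/
theorem isFactor_of_forall (hM : ∀ z : M.toStarSubalgebra, IsStarProjection z →
    z ∈ Set.center M.toStarSubalgebra → z = 0 ∨ z = 1) : M.IsFactor := by
  have hsa : ∀ a : M.toStarSubalgebra, IsSelfAdjoint a → a ∈ Set.center M.toStarSubalgebra →
      ∃ r : ℝ, a = algebraMap ℝ M.toStarSubalgebra r := by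
    intro a ha hac
    have hc := Semigroup.mem_center_iff.1 hac
    have hsub : (spectrum ℝ a).Subsingleton := by
      intro r₁ h₁ r₂ h₂
      by_contra hne
      wlog hlt : r₁ < r₂ generalizing r₁ r₂
      · exact this h₂ h₁ (Ne.symm hne) (lt_of_le_of_ne (not_lt.1 hlt) (Ne.symm hne))
      -- If the spectrum had two points, `f` and `g`, supported on either side of their midpoint,
      -- would give nonzero `f(a)` and `g(a)` with product zero. The range projection of `f(a)` is
      -- then central and differs from `0` and `1`.
      let f : ℝ → ℝ := fun t => max 0 (t - (r₁ + r₂) / 2)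
      let g : ℝ → ℝ := fun t => max 0 ((r₁ + r₂) / 2 - t)
      have hf : Continuous f := by fun_prop
      have hg : Continuous g := by fun_prop
      have hgf : cfc g a * cfc f a = 0 := by
        rw [← cfc_mul g f a hg.continuousOn hf.continuousOn]
        have : (fun t => g t * f t) = fun _ => 0 := by
          funext t
          rcases le_total t ((r₁ + r₂) / 2) with h | h
          · simp [f, max_eq_left (sub_nonpos.2 h)]
          · simp [g, max_eq_left (sub_nonpos.2 h)]
        rw [this, cfc_const_zero]
      have hne0 : ∀ k : ℝ → ℝ, Continuous k → ∀ r ∈ spectrum ℝ a, k r ≠ 0 → cfc k a ≠ 0 := by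
        intro k hk r hr hkr h0
        have h1 : k r ∈ spectrum ℝ (cfc k a) := by
          rw [cfc_map_spectrum k a ha hk.continuousOn]
          exact ⟨r, hr, rfl⟩
        have : Nontrivial M.toStarSubalgebra := by
          by_contra hn
          rw [not_nontrivial_iff_subsingleton] at hn
          rw [spectrum.of_subsingleton] at hr
          exact hr
        rw [h0, spectrum.zero_eq] at h1
        exact hkr h1
      have hf0 : cfc f a ≠ 0 := hne0 f hf r₂ h₂ (by
        have : 0 < r₂ - (r₁ + r₂) / 2 := by linarith
        exact (lt_max_of_lt_right this).ne')
      have hg0 : cfc g a ≠ 0 := hne0 g hg r₁ h₁ (by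
        have : 0 < (r₁ + r₂) / 2 - r₁ := by linarith
        exact (lt_max_of_lt_right this).ne')
      obtain ⟨z, hz, hzf, hX⟩ := M.exists_rangeProjection {cfc f a}
      simp only [Set.mem_singleton_iff, forall_eq] at hzf hX
      have hzc : z ∈ Set.center M.toStarSubalgebra := hz.mem_center_of_mul_mul fun b => hX _ (by
        have hab : Commute a b := (hc b).symm
        rw [mul_assoc, ← (hab.cfc_real f).eq, ← mul_assoc, sub_mul, one_mul, hzf, sub_self,
          zero_mul])
      rcases hM z hz hzc with rfl | rfl
      · exact hf0 (by rw [← hzf, zero_mul])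
      · exact hg0 (by rw [← mul_one (cfc g a)]; exact hX _ hgf)
    rcases hsub.eq_empty_or_singleton with h | ⟨r, h⟩
    · exact ⟨0, CFC.eq_algebraMap_of_spectrum_subset_singleton a 0 (by rw [h]; simp) ha⟩
    · exact ⟨r, CFC.eq_algebraMap_of_spectrum_subset_singleton a r (by rw [h]) ha⟩
  refine le_antisymm (fun c hc => ?_) bot_le
  have hc' := Subalgebra.mem_center_iff.1 hc
  have hcs : ∀ b, b * star c = star c * b := fun b => by
    have := congrArg star (hc' (star b))
    simpa only [star_mul, star_star] using this.symm
  obtain ⟨r, hr⟩ := hsa (c + star c) (by simp [isSelfAdjoint_iff, add_comm])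
    (Semigroup.mem_center_iff.2 fun b => by rw [mul_add, add_mul, hc', hcs])
  obtain ⟨r', hr'⟩ := hsa (Complex.I • (c - star c))
    (by simp [isSelfAdjoint_iff, star_smul, smul_sub, neg_add_eq_sub])
    (Semigroup.mem_center_iff.2 fun b => by
      rw [mul_smul_comm, smul_mul_assoc, mul_sub, sub_mul, hc', hcs])
  rw [Algebra.mem_bot]
  -- With `r` and `r'` the scalars of `c + c*` and `i(c - c*)`, this combination recovers `c`.
  refine ⟨(1 / 2 : ℂ) * (r - Complex.I * r'), ?_⟩
  have e1 : algebraMap ℂ M.toStarSubalgebra r = c + star c := by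
    rw [hr]; exact (IsScalarTower.algebraMap_apply ℝ ℂ M.toStarSubalgebra r).symm
  have e2 : algebraMap ℂ M.toStarSubalgebra r' = Complex.I • (c - star c) := by
    rw [hr']; exact (IsScalarTower.algebraMap_apply ℝ ℂ M.toStarSubalgebra r').symm
  rw [map_mul, map_sub, map_mul, e1, e2, Algebra.algebraMap_eq_smul_one (1 / 2 : ℂ),
    Algebra.algebraMap_eq_smul_one Complex.I, smul_mul_assoc, one_mul, smul_mul_assoc, one_mul,
    smul_smul, Complex.I_mul_I]
  module

/-- The largest finite central projection. -/
theorem exists_greatest_finite_central (M : VonNeumannAlgebra H) :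
    ∃ z : M.toStarSubalgebra, IsStarProjection z ∧ z ∈ Set.center M.toStarSubalgebra ∧
      ¬ IsInfiniteProjection z ∧ ∀ c : M.toStarSubalgebra, IsStarProjection c →
        c ∈ Set.center M.toStarSubalgebra → ¬ IsInfiniteProjection c → z * c = c := by
  obtain ⟨z, hz, hzs, hX⟩ := M.exists_rangeProjection {c | IsStarProjection c ∧
    c ∈ Set.center M.toStarSubalgebra ∧ ¬ IsInfiniteProjection c}
  refine ⟨z, hz, hz.mem_center_of_mul_mul fun b => hX _ fun c hc => ?_, ?_,
    fun c h1 h2 h3 => hzs c ⟨h1, h2, h3⟩⟩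
  · rw [mul_assoc, Semigroup.mem_center_iff.1 hc.2.1 b, ← mul_assoc, sub_mul, one_mul, hzs c hc,
      sub_self, zero_mul]
  · rintro ⟨-, q, hq, hzq, hne, v, hv, hv'⟩
    -- An equivalence of `z` with `q ≤ z` restricts to one of `c` with `q c` for each finite central
    -- `c`, so `q c = c`. As `z` is generated by these `c`, it follows that `q = z`.
    have h1 : (1 - q) * z = 0 := hX _ fun c hc => by
      obtain ⟨hc1, hc2, hc3⟩ := hc
      obtain ⟨hcc, hcs⟩ := isStarProjection_iff'.1 hc1
      obtain ⟨hqq, hqs⟩ := isStarProjection_iff'.1 hq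
      have hcc' := Semigroup.mem_center_iff.1 hc2
      have h2 : q * c = c := by
        by_contra h
        refine hc3 ⟨hc1, q * c, isStarProjection_iff'.2 ⟨?_, ?_⟩, ?_, h, v * c, ?_, ?_⟩
        · rw [mul_assoc, ← mul_assoc c, ← hcc' q, mul_assoc q c, hcc, ← mul_assoc, hqq]
        · rw [star_mul, hcs, hqs, hcc']
        · rw [← mul_assoc, ← hcc' q, mul_assoc, hcc]
        · calc star (v * c) * (v * c) = c * (star v * v) * c := by
                simp only [star_mul, hcs, mul_assoc]
            _ = c := by rw [hv, mul_assoc, hzs c ⟨hc1, hc2, hc3⟩, hcc]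
        · calc v * c * star (v * c) = v * (c * c) * star v := by
                simp only [star_mul, hcs, mul_assoc]
            _ = q * c := by rw [hcc, mul_assoc, ← hcc' (star v), ← mul_assoc, hv']
      rw [sub_mul, one_mul, h2, sub_self]
    rw [sub_mul, one_mul, sub_eq_zero] at h1
    have h2 := congrArg star h1
    rw [star_mul, hz.isSelfAdjoint.star_eq, hq.isSelfAdjoint.star_eq, hzq] at h2
    exact hne h2.symm

end VonNeumannAlgebra

/-! ### Gluing elements along a central projection. -/

section Glue

variable {A : Type*} [Ring A] [StarRing A]

theorem glue_mul_glue {z : A} (hz : IsStarProjection z) (hzc : z ∈ Set.center A) (a b c d : A) :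
    (z * a + (1 - z) * b) * (z * c + (1 - z) * d) = z * (a * c) + (1 - z) * (b * d) := by
  have hc := Semigroup.mem_center_iff.1 hzc
  have hzz : z * z = z := hz.isIdempotentElem.eq
  have e1 : ∀ a c : A, z * a * (z * c) = z * (a * c) := fun a c => by
    rw [mul_assoc z, ← mul_assoc a, hc a, mul_assoc z a, ← mul_assoc z z, hzz]
  calc (z * a + (1 - z) * b) * (z * c + (1 - z) * d)
      = z * a * (z * c) + (z * a * d - z * a * (z * d)) + (b * (z * c) - z * b * (z * c)) +
        (b * d - z * b * d - b * (z * d) + z * b * (z * d)) := by noncomm_ring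
    _ = _ := by
      rw [e1, e1, e1, e1, ← mul_assoc b z, ← mul_assoc b z, hc b]
      noncomm_ring

theorem star_glue {z : A} (hz : IsStarProjection z) (hzc : z ∈ Set.center A) (a b : A) :
    star (z * a + (1 - z) * b) = z * star a + (1 - z) * star b := by
  have hc := Semigroup.mem_center_iff.1 hzc
  rw [star_add, star_mul, star_mul, star_sub, star_one, hz.isSelfAdjoint.star_eq, hc, mul_sub,
    sub_mul, one_mul, mul_one, hc]

theorem mul_glue {z : A} (hz : IsStarProjection z) (a b : A) :
    z * (z * a + (1 - z) * b) = z * a := by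
  rw [mul_add, ← mul_assoc, ← mul_assoc, hz.isIdempotentElem.eq, hz.mul_one_sub_self, zero_mul,
    add_zero]

theorem one_sub_mul_glue {z : A} (hz : IsStarProjection z) (a b : A) :
    (1 - z) * (z * a + (1 - z) * b) = (1 - z) * b := by
  rw [mul_add, ← mul_assoc, ← mul_assoc, hz.one_sub.isIdempotentElem.eq, hz.one_sub_mul_self,
    zero_mul, zero_add]

theorem glue_self {A : Type*} [Ring A] (z a : A) : z * a + (1 - z) * a = a := by noncomm_ring

end Glue

/-- With `g` the glued element, `1 - g*g` is the sum of the compressions of `1 - a*a` by `z` and of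
`1 - b*b` by `1 - z`, both positive. -/
theorem norm_glue_le_one {A : Type*} [CStarAlgebra A] {z : A} (hz : IsStarProjection z)
    (hzc : z ∈ Set.center A) {a b : A} (ha : ‖a‖ ≤ 1) (hb : ‖b‖ ≤ 1) :
    ‖z * a + (1 - z) * b‖ ≤ 1 := by
  let _ := CStarAlgebra.spectralOrder A
  have := CStarAlgebra.spectralOrderedRing A
  have key : ∀ a : A, ‖a‖ ≤ 1 ↔ 0 ≤ 1 - star a * a := fun a => by
    rw [sub_nonneg, ← CStarAlgebra.norm_le_one_iff_of_nonneg _ (star_mul_self_nonneg a),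
      CStarRing.norm_star_mul_self, ← sq, sq_le_one_iff₀ (norm_nonneg a)]
  rw [key] at ha hb ⊢
  have hc := Semigroup.mem_center_iff.1 hzc
  have h : 1 - star (z * a + (1 - z) * b) * (z * a + (1 - z) * b) =
      star z * (1 - star a * a) * z + star (1 - z) * (1 - star b * b) * (1 - z) := by
    have e : ∀ p : A, IsStarProjection p → (∀ g, g * p = p * g) → ∀ g, star p * g * p = p * g :=
      fun p hp hpc g => by
        rw [hp.isSelfAdjoint.star_eq, mul_assoc, hpc, ← mul_assoc, hp.isIdempotentElem.eq]
    rw [star_glue hz hzc, glue_mul_glue hz hzc, e z hz hc, e (1 - z) hz.one_sub fun g => by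
      rw [mul_sub, sub_mul, hc, mul_one, one_mul]]
    noncomm_ring
  rw [h]
  exact add_nonneg (star_left_conjugate_nonneg ha _) (star_left_conjugate_nonneg hb _)

namespace VonNeumannAlgebra

attribute [local instance] cstarAlgebra

variable {H : Type u} [NormedAddCommGroup H] [InnerProductSpace ℂ H] [CompleteSpace H]
  {M : VonNeumannAlgebra H}

/-- Replacing each `yᵢ` by `z yᵢ + (1 - z)` turns a combination of the glued point into one of `z a
+ (1 - z)`, and similarly on the other side. The two resulting unitaries are glued along `z`. -/
theorem isCStarExtremePoint_glue {z a b : M.toStarSubalgebra} (hz : IsStarProjection z)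
    (hzc : z ∈ Set.center M.toStarSubalgebra) (ha : IsCStarExtremePoint (z * a + (1 - z)))
    (hb : IsCStarExtremePoint (z + (1 - z) * b)) :
    IsCStarExtremePoint (z * a + (1 - z) * b) := by
  have hc := Semigroup.mem_center_iff.1 hzc
  have hc' : ∀ g, g * (1 - z) = (1 - z) * g := fun g => by
    rw [mul_sub, sub_mul, mul_one, one_mul, hc g]
  have h1 : ‖(1 : M.toStarSubalgebra)‖ ≤ 1 :=
    norm_le_one_of_star_mul_self (by rw [star_one, one_mul])
  have hnorm : ∀ {a b : M.toStarSubalgebra}, ‖a‖ ≤ 1 → ‖b‖ ≤ 1 →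
      z * a + (1 - z) * b ∈ Metric.closedBall (0 : M.toStarSubalgebra) 1 := fun ha hb =>
    mem_closedBall_zero_iff.2 (norm_glue_le_one hz hzc ha hb)
  have hleft : z * (z * a + (1 - z)) = z * a := by simpa using mul_glue hz a 1
  have hright : (1 - z) * (z + (1 - z) * b) = (1 - z) * b := by
    simpa using one_sub_mul_glue hz 1 b
  refine ⟨?_, fun k t y ht hy htt hxy i => ?_⟩
  · have := hnorm (mem_closedBall_zero_iff.1 ha.1) (mem_closedBall_zero_iff.1 hb.1)
    rwa [hleft, hright] at this
  · have hy' := fun i => mem_closedBall_zero_iff.1 (hy i)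
    have hxz : ∑ i, z * (star (t i) * y i * t i) = z * a := by
      rw [← Finset.mul_sum, ← hxy, mul_glue hz]
    have hxz' : ∑ i, (1 - z) * (star (t i) * y i * t i) = (1 - z) * b := by
      rw [← Finset.mul_sum, ← hxy, one_sub_mul_glue hz]
    have htz : ∀ z : M.toStarSubalgebra, ∑ i, z * (star (t i) * t i) = z := fun z => by
      rw [← Finset.mul_sum, htt, mul_one]
    obtain ⟨w, hw, hwy⟩ := ha.2 k t (fun i => z * y i + (1 - z) * 1) ht
      (fun i => hnorm (hy' i) h1) htt (by
        have : ∀ i, star (t i) * (z * y i + (1 - z) * 1) * t i =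
            z * (star (t i) * y i * t i) + (1 - z) * (star (t i) * t i) := fun i => by
          rw [mul_one, mul_add, add_mul, ← mul_assoc, hc, hc']
          simp only [mul_assoc]
        simp only [this]
        rw [Finset.sum_add_distrib, hxz, htz]) i
    obtain ⟨w', hw', hwy'⟩ := hb.2 k t (fun i => z * 1 + (1 - z) * y i) ht
      (fun i => hnorm h1 (hy' i)) htt (by
        have : ∀ i, star (t i) * (z * 1 + (1 - z) * y i) * t i =
            z * (star (t i) * t i) + (1 - z) * (star (t i) * y i * t i) := fun i => by
          rw [mul_one, mul_add, add_mul, ← mul_assoc, hc, ← mul_assoc, hc']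
          simp only [mul_assoc]
        simp only [this]
        rw [Finset.sum_add_distrib, hxz', htz]) i
    have e1 : z * y i = z * (star w * a * w) := by
      rw [← mul_glue hz (y i) 1, hwy, ← mul_assoc, ← mul_assoc, ← hc (star w), mul_assoc (star w),
        hleft, ← mul_assoc, hc (star w)]
      simp only [mul_assoc]
    have e2 : (1 - z) * y i = (1 - z) * (star w' * b * w') := by
      rw [← one_sub_mul_glue hz 1 (y i), hwy', ← mul_assoc, ← mul_assoc, ← hc' (star w'),
        mul_assoc (star w'), hright, ← mul_assoc, hc' (star w')]
      simp only [mul_assoc]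
    refine ⟨z * w + (1 - z) * w', Unitary.mem_iff.2 ⟨?_, ?_⟩, ?_⟩
    · rw [star_glue hz hzc, glue_mul_glue hz hzc, Unitary.star_mul_self_of_mem hw,
        Unitary.star_mul_self_of_mem hw', glue_self]
    · rw [star_glue hz hzc, glue_mul_glue hz hzc, Unitary.mul_star_self_of_mem hw,
        Unitary.mul_star_self_of_mem hw', glue_self]
    · rw [star_glue hz hzc, glue_mul_glue hz hzc, glue_mul_glue hz hzc, ← e1, ← e2, glue_self]

/-- Gluing a proper isometry of one summand and a proper coisometry of the other. -/
theorem hasFiniteCentralSplittings_of_setOf_isCStarExtremePoint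
    (h : {x : M.toStarSubalgebra | IsCStarExtremePoint x} =
      {x : M.toStarSubalgebra | star x * x = 1} ∪ {x : M.toStarSubalgebra | x * star x = 1}) :
    HasFiniteCentralSplittings M.toStarSubalgebra := by
  intro z hz hzc
  by_contra hcon
  rw [not_or, not_not, not_not] at hcon
  obtain ⟨⟨-, q, hq, hzq, hqz, hv⟩, ⟨-, q', hq', hzq', hqz', hv'⟩⟩ := hcon
  obtain ⟨v, hv1, hv2, hvz, hqv⟩ := hv.exists_mul_eq hz hq
  obtain ⟨v', hv1', hv2', hvz', hqv'⟩ := hv'.exists_mul_eq hz.one_sub hq'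
  have hzv : z * v = v := by rw [← Semigroup.mem_center_iff.1 hzc, hvz]
  have g1 : ∀ a b c d : M.toStarSubalgebra, (z * a + (1 - z) * b) * (z * c + (1 - z) * d) =
    z * (a * c) + (1 - z) * (b * d) := glue_mul_glue hz hzc
  have g2 : ∀ a b : M.toStarSubalgebra, star (z * a + (1 - z) * b) =
    z * star a + (1 - z) * star b := star_glue hz hzc
  have h1 : IsCStarExtremePoint (z * v + (1 - z)) := isCStarExtremePoint_of_isometry (by
    have e := g1 (star v) 1 v 1
    have e' := g2 v 1
    simp only [mul_one, star_one] at e e'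
    rw [e', e, hv1, hz.isIdempotentElem.eq, add_sub_cancel])
  have h2 : IsCStarExtremePoint (z + (1 - z) * star v') := isCStarExtremePoint_of_coisometry (by
    have e := g1 1 (star v') 1 v'
    have e' := g2 1 (star v')
    simp only [mul_one, star_one, star_star] at e e'
    rw [e', e, hv1', hz.one_sub.isIdempotentElem.eq, add_sub_cancel])
  have h3 : z * v + (1 - z) * star v' ∈ {x : M.toStarSubalgebra | star x * x = 1} ∪
      {x : M.toStarSubalgebra | x * star x = 1} := h ▸ isCStarExtremePoint_glue hz hzc h1 h2
  -- An isometry would force `q' = 1 - z` on the second summand; a coisometry would force `q = z` on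
  -- the first.
  rcases h3 with h3 | h3
  · rw [Set.mem_ofPred_eq, g2, g1, star_star, hv2'] at h3
    have := congrArg ((1 - z) * ·) h3
    simp only [one_sub_mul_glue hz, mul_one] at this
    exact hqz' (hzq'.symm.trans this)
  · rw [Set.mem_ofPred_eq, g2, g1, star_star, hv2] at h3
    have := congrArg (z * ·) h3
    simp only [mul_glue hz, mul_one] at this
    exact hqz (hzq.symm.trans this)

end VonNeumannAlgebra

/-! ### Corners of a von Neumann algebra and direct sums. -/

section Corner

open ContinuousLinearMap

variable {H : Type u} [NormedAddCommGroup H] [InnerProductSpace ℂ H]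

theorem IsStarProjection.exists_starProjection_eq [CompleteSpace H] {z : H →L[ℂ] H} (hz : IsStarProjection z) :
    ∃ (K : Submodule ℂ H) (_ : CompleteSpace K), K.starProjection = z := by
  let K : Submodule ℂ H := LinearMap.ker ((1 - z : H →L[ℂ] H) : H →ₗ[ℂ] H)
  have hK : CompleteSpace K := (1 - z).isClosed_ker.completeSpace_coe
  have hmem : ∀ ξ, ξ ∈ K ↔ z ξ = ξ := fun ξ => by
    change ξ - z ξ = 0 ↔ _
    rw [sub_eq_zero, eq_comm]
  refine ⟨K, hK, ?_⟩
  ext ξ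
  refine Submodule.eq_starProjection_of_mem_of_inner_eq_zero ((hmem _).2 ?_) fun η hη => ?_
  · exact congrArg (fun T : H →L[ℂ] H => T ξ) hz.isIdempotentElem.eq
  · rw [← (hmem η).1 hη]
    have h1 : inner ℂ (ξ - z ξ) (z η) = inner ℂ (z (ξ - z ξ)) η := by
      have := ContinuousLinearMap.adjoint_inner_left z η (ξ - z ξ)
      rw [← ContinuousLinearMap.star_eq_adjoint, hz.isSelfAdjoint.star_eq] at this
      exact this.symm
    have h2 : z (ξ - z ξ) = 0 :=
      congrArg (fun T : H →L[ℂ] H => T ξ) hz.mul_one_sub_self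
    rw [h1, h2, inner_zero_left]

/-- Extension by zero of an operator on a closed subspace. -/
noncomputable def Submodule.extendOp (K : Submodule ℂ H) [CompleteSpace K] (T : K →L[ℂ] K) :
    H →L[ℂ] H :=
  K.subtypeL ∘L T ∘L K.orthogonalProjectionOnto

/-- Compression of an operator to a closed subspace. -/
noncomputable def Submodule.compressOp (K : Submodule ℂ H) [CompleteSpace K] (T : H →L[ℂ] H) :
    K →L[ℂ] K :=
  K.orthogonalProjectionOnto ∘L T ∘L K.subtypeL

namespace Submodule

variable (K : Submodule ℂ H) [CompleteSpace K]

theorem orthogonalProjectionOnto_coe (k : K) : K.orthogonalProjectionOnto (k : H) = k :=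
  orthogonalProjectionOnto_mem_subspace_eq_self k

theorem extendOp_apply (T : K →L[ℂ] K) (ξ : H) :
    K.extendOp T ξ = T (K.orthogonalProjectionOnto ξ) := rfl

theorem compressOp_apply (T : H →L[ℂ] H) (k : K) :
    K.compressOp T k = K.orthogonalProjectionOnto (T k) := rfl

theorem extendOp_mul (S T : K →L[ℂ] K) : K.extendOp (S * T) = K.extendOp S * K.extendOp T := by
  ext ξ
  simp only [extendOp_apply, mul_apply_eq_comp, orthogonalProjectionOnto_coe]

theorem extendOp_add (S T : K →L[ℂ] K) : K.extendOp (S + T) = K.extendOp S + K.extendOp T := by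
  ext ξ
  simp [extendOp_apply]

theorem extendOp_smul (c : ℂ) (T : K →L[ℂ] K) : K.extendOp (c • T) = c • K.extendOp T := by
  ext ξ
  simp [extendOp_apply]

theorem extendOp_one : K.extendOp 1 = K.starProjection := rfl

theorem extendOp_star [CompleteSpace H] (T : K →L[ℂ] K) : K.extendOp (star T) = star (K.extendOp T) := by
  rw [extendOp, extendOp, ContinuousLinearMap.star_eq_adjoint, ContinuousLinearMap.star_eq_adjoint,
    adjoint_comp, adjoint_comp, adjoint_subtypeL, adjoint_orthogonalProjectionOnto,
    ContinuousLinearMap.comp_assoc]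

theorem compressOp_extendOp (T : K →L[ℂ] K) : K.compressOp (K.extendOp T) = T := by
  ext k
  simp only [compressOp_apply, extendOp_apply, orthogonalProjectionOnto_coe]

theorem extendOp_compressOp (T : H →L[ℂ] H) :
    K.extendOp (K.compressOp T) = K.starProjection * T * K.starProjection := rfl

theorem extendOp_injective : Function.Injective K.extendOp :=
  Function.LeftInverse.injective K.compressOp_extendOp

end Submodule

namespace VonNeumannAlgebra

attribute [local instance] cstarAlgebra

variable [CompleteSpace H] (M : VonNeumannAlgebra H) (K : Submodule ℂ H) [CompleteSpace K]

/-- The corner of a von Neumann algebra, acting on the range of a projection of the algebra. -/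
noncomputable def corner (hK : K.starProjection ∈ M.toStarSubalgebra) : VonNeumannAlgebra K where
  carrier := {T | K.extendOp T ∈ M.toStarSubalgebra}
  mul_mem' {S T} hS hT := by
    change K.extendOp (S * T) ∈ M.toStarSubalgebra
    rw [K.extendOp_mul]
    exact mul_mem hS hT
  add_mem' {S T} hS hT := by
    change K.extendOp (S + T) ∈ M.toStarSubalgebra
    rw [K.extendOp_add]
    exact add_mem hS hT
  algebraMap_mem' r := by
    change K.extendOp _ ∈ M.toStarSubalgebra
    rw [Algebra.algebraMap_eq_smul_one, K.extendOp_smul, K.extendOp_one]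
    exact SMulMemClass.smul_mem r hK
  star_mem' {T} hT := by
    change K.extendOp (star T) ∈ M.toStarSubalgebra
    rw [K.extendOp_star]
    exact star_mem hT
  centralizer_centralizer' := by
    -- It suffices that the extension of `T` commutes with each `S` in the commutant of `M`. The
    -- compression of `S` to `K` commutes with the corner, hence with `T`, and extending by zero
    -- gives the claim.
    refine Set.Subset.antisymm (fun T hT => M.mem_of_commute fun S hS => ?_)
      Set.subset_centralizer_centralizer
    have hSP : S * K.starProjection = K.starProjection * S := M.commute_of_mem hS hK
    have hPP : K.starProjection * K.starProjection = K.starProjection :=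
      isStarProjection_starProjection.isIdempotentElem.eq
    have hPT : ∀ T, K.starProjection * K.extendOp T = K.extendOp T := fun T => by
      rw [← K.extendOp_one, ← K.extendOp_mul, one_mul]
    have hTP : ∀ T, K.extendOp T * K.starProjection = K.extendOp T := fun T => by
      rw [← K.extendOp_one, ← K.extendOp_mul, mul_one]
    have hl : ∀ T, K.extendOp (K.compressOp S * T) = S * K.extendOp T := fun T => by
      rw [K.extendOp_mul, K.extendOp_compressOp, ← hSP, mul_assoc S, hPP, mul_assoc, hPT]
    have hr : ∀ T, K.extendOp (T * K.compressOp S) = K.extendOp T * S := fun T => by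
      rw [K.extendOp_mul, K.extendOp_compressOp, ← mul_assoc, ← mul_assoc, hTP, mul_assoc, hSP,
        ← mul_assoc, hTP]
    have hcS : K.compressOp S ∈ Set.centralizer {T | K.extendOp T ∈ M.toStarSubalgebra} := by
      rw [Set.mem_centralizer_iff]
      intro T hT
      refine K.extendOp_injective ?_
      rw [hl, hr]
      exact (M.commute_of_mem hS hT).eq.symm
    have := Set.mem_centralizer_iff.1 hT _ hcS
    have := congrArg K.extendOp this
    rwa [hl, hr] at this

theorem mem_corner_iff {hK : K.starProjection ∈ M.toStarSubalgebra} {T : K →L[ℂ] K} :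
    T ∈ (M.corner K hK).toStarSubalgebra ↔ K.extendOp T ∈ M.toStarSubalgebra := Iff.rfl

variable {K} in
theorem extendOp_compressOp_of_commute
    (hc : ∀ m ∈ M.toStarSubalgebra, m * K.starProjection = K.starProjection * m)
    (m : M.toStarSubalgebra) : K.extendOp (K.compressOp m.1) = K.starProjection * m.1 := by
  rw [K.extendOp_compressOp, mul_assoc, hc m.1 m.2, ← mul_assoc,
    isStarProjection_starProjection.isIdempotentElem.eq]

/-- Compression to the range of a central projection is a homomorphism. -/
noncomputable def cornerHom (hK : K.starProjection ∈ M.toStarSubalgebra)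
    (hc : ∀ m ∈ M.toStarSubalgebra, m * K.starProjection = K.starProjection * m) :
    M.toStarSubalgebra →⋆ₐ[ℂ] (M.corner K hK).toStarSubalgebra where
  toFun m := ⟨K.compressOp m.1, by
    rw [mem_corner_iff, M.extendOp_compressOp_of_commute hc]
    exact mul_mem hK m.2⟩
  map_one' := Subtype.ext (K.extendOp_injective (by
    change K.extendOp (K.compressOp (1 : M.toStarSubalgebra).1) = K.extendOp 1
    rw [M.extendOp_compressOp_of_commute hc, K.extendOp_one]
    exact mul_one _))
  map_mul' m n := Subtype.ext (K.extendOp_injective (by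
    change K.extendOp (K.compressOp (m * n).1) =
      K.extendOp (K.compressOp m.1 * K.compressOp n.1)
    rw [K.extendOp_mul]
    simp only [M.extendOp_compressOp_of_commute hc]
    rw [mul_assoc, ← mul_assoc m.1, hc m.1 m.2, mul_assoc, ← mul_assoc K.starProjection,
      isStarProjection_starProjection.isIdempotentElem.eq]
    rfl))
  map_zero' := Subtype.ext (K.extendOp_injective (by
    change K.extendOp (K.compressOp (0 : M.toStarSubalgebra).1) = K.extendOp 0
    rw [M.extendOp_compressOp_of_commute hc]
    ext ξ
    simp [K.extendOp_apply]))
  map_add' m n := Subtype.ext (K.extendOp_injective (by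
    change K.extendOp (K.compressOp (m + n).1) =
      K.extendOp (K.compressOp m.1 + K.compressOp n.1)
    rw [K.extendOp_add]
    simp only [M.extendOp_compressOp_of_commute hc]
    exact mul_add _ _ _))
  commutes' r := Subtype.ext (K.extendOp_injective (by
    change K.extendOp (K.compressOp (algebraMap ℂ M.toStarSubalgebra r).1) =
      K.extendOp (algebraMap ℂ (K →L[ℂ] K) r)
    rw [M.extendOp_compressOp_of_commute hc, Algebra.algebraMap_eq_smul_one,
      Algebra.algebraMap_eq_smul_one, K.extendOp_smul, K.extendOp_one]
    exact (mul_smul_comm r _ _).trans (congrArg _ (mul_one _))))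
  map_star' m := Subtype.ext (K.extendOp_injective (by
    change K.extendOp (K.compressOp (star m).1) = K.extendOp (star (K.compressOp m.1))
    rw [K.extendOp_star]
    simp only [M.extendOp_compressOp_of_commute hc]
    rw [star_mul, isStarProjection_starProjection.isSelfAdjoint.star_eq]
    exact (hc _ (star m).2).symm))

theorem extendOp_cornerHom {hK : K.starProjection ∈ M.toStarSubalgebra}
    {hc : ∀ m ∈ M.toStarSubalgebra, m * K.starProjection = K.starProjection * m}
    (m : M.toStarSubalgebra) : K.extendOp (M.cornerHom K hK hc m).1 = K.starProjection * m.1 :=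
  M.extendOp_compressOp_of_commute hc m

/-- A central projection splits the algebra into the direct sum of two corners. -/
theorem exists_equiv_corner_prod {z : M.toStarSubalgebra} (hz : IsStarProjection z)
    (hzc : z ∈ Set.center M.toStarSubalgebra) :
    ∃ (H₁ : Type u) (_ : NormedAddCommGroup H₁) (_ : InnerProductSpace ℂ H₁)
      (_ : CompleteSpace H₁) (H₂ : Type u) (_ : NormedAddCommGroup H₂)
      (_ : InnerProductSpace ℂ H₂) (_ : CompleteSpace H₂)
      (N : VonNeumannAlgebra H₁) (R : VonNeumannAlgebra H₂)
      (e : M.toStarSubalgebra ≃⋆ₐ[ℂ] (N.toStarSubalgebra × R.toStarSubalgebra)), e z = (1, 0) := by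
  have hz' : IsStarProjection z.1 := isStarProjection_iff'.2
    ⟨congrArg Subtype.val hz.isIdempotentElem.eq, congrArg Subtype.val hz.isSelfAdjoint.star_eq⟩
  obtain ⟨K₁, hc₁, hK₁⟩ := hz'.exists_starProjection_eq
  obtain ⟨K₂, hc₂, hK₂⟩ := hz'.one_sub.exists_starProjection_eq
  have hm₁ : K₁.starProjection ∈ M.toStarSubalgebra := hK₁ ▸ z.2
  have hm₂ : K₂.starProjection ∈ M.toStarSubalgebra := hK₂ ▸ (1 - z).2
  have hcomm : ∀ m ∈ M.toStarSubalgebra, m * z.1 = z.1 * m := fun m hm =>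
    congrArg Subtype.val (Semigroup.mem_center_iff.1 hzc ⟨m, hm⟩)
  have hcomm₁ : ∀ m ∈ M.toStarSubalgebra, m * K₁.starProjection = K₁.starProjection * m := by
    rw [hK₁]; exact hcomm
  have hcomm₂ : ∀ m ∈ M.toStarSubalgebra, m * K₂.starProjection = K₂.starProjection * m := by
    rw [hK₂]
    intro m hm
    rw [mul_sub, sub_mul, hcomm m hm, mul_one, one_mul]
  have hadd : K₁.starProjection + K₂.starProjection = 1 := by rw [hK₁, hK₂, add_sub_cancel]
  have h12 : K₁.starProjection * K₂.starProjection = 0 := by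
    rw [hK₁, hK₂, hz'.mul_one_sub_self]
  have h21 : K₂.starProjection * K₁.starProjection = 0 := by
    rw [hK₁, hK₂, hz'.one_sub_mul_self]
  let φ₁ := M.cornerHom K₁ hm₁ hcomm₁
  let φ₂ := M.cornerHom K₂ hm₂ hcomm₂
  have hφ₁ : ∀ m, K₁.extendOp (φ₁ m).1 = K₁.starProjection * m.1 := M.extendOp_cornerHom K₁
  have hφ₂ : ∀ m, K₂.extendOp (φ₂ m).1 = K₂.starProjection * m.1 := M.extendOp_cornerHom K₂
  have hbij : Function.Bijective (φ₁.prod φ₂) := by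
    constructor
    · intro m n hmn
      have e₁ : K₁.starProjection * m.1 = K₁.starProjection * n.1 := by
        rw [← hφ₁, ← hφ₁]
        exact congrArg (fun a => K₁.extendOp a.1.1) hmn
      have e₂ : K₂.starProjection * m.1 = K₂.starProjection * n.1 := by
        rw [← hφ₂, ← hφ₂]
        exact congrArg (fun a => K₂.extendOp a.2.1) hmn
      refine Subtype.ext ?_
      rw [← one_mul m.1, ← one_mul n.1, ← hadd, add_mul, add_mul, e₁, e₂]
    · rintro ⟨S, T⟩
      have hS : K₁.extendOp S.1 = K₁.starProjection * K₁.extendOp S.1 := by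
        rw [← K₁.extendOp_one, ← K₁.extendOp_mul, one_mul]
      have hT : K₂.extendOp T.1 = K₂.starProjection * K₂.extendOp T.1 := by
        rw [← K₂.extendOp_one, ← K₂.extendOp_mul, one_mul]
      refine ⟨⟨K₁.extendOp S.1 + K₂.extendOp T.1, add_mem S.2 T.2⟩,
        Prod.ext (Subtype.ext (K₁.extendOp_injective ?_))
          (Subtype.ext (K₂.extendOp_injective ?_))⟩
      · refine (hφ₁ _).trans ?_
        change K₁.starProjection * (K₁.extendOp S.1 + K₂.extendOp T.1) = _
        rw [mul_add, ← hS, hT, ← mul_assoc, h12, zero_mul, add_zero]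
      · refine (hφ₂ _).trans ?_
        change K₂.starProjection * (K₁.extendOp S.1 + K₂.extendOp T.1) = _
        rw [mul_add, ← hT, hS, ← mul_assoc, h21, zero_mul, zero_add]
  refine ⟨K₁, inferInstance, inferInstance, hc₁, K₂, inferInstance, inferInstance, hc₂,
    M.corner K₁ hm₁, M.corner K₂ hm₂, StarAlgEquiv.ofBijective (φ₁.prod φ₂) hbij,
    Prod.ext (Subtype.ext (K₁.extendOp_injective ?_)) (Subtype.ext (K₂.extendOp_injective ?_))⟩
  · refine (hφ₁ z).trans ?_
    rw [← hK₁, isStarProjection_starProjection.isIdempotentElem.eq]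
    rfl
  · refine (hφ₂ z).trans ?_
    rw [← hK₁, h21]
    ext ξ
    simp [K₂.extendOp_apply]

end VonNeumannAlgebra

end Corner

/-! ### Classification of the algebras satisfying the splitting condition. -/

namespace VonNeumannAlgebra

attribute [local instance] cstarAlgebra

variable {H : Type u} [NormedAddCommGroup H] [InnerProductSpace ℂ H] [CompleteSpace H]
  {M : VonNeumannAlgebra H}

/-- An infinite algebra without two infinite complementary central summands is the direct sum of a
finite algebra and a properly infinite factor. -/
theorem exists_isDirectSum_of_hasFiniteCentralSplittings
    (hM : HasFiniteCentralSplittings M.toStarSubalgebra) (hinf : ¬ M.IsFinite) :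
    ∃ (H₁ : Type u) (_ : NormedAddCommGroup H₁) (_ : InnerProductSpace ℂ H₁)
      (_ : CompleteSpace H₁) (H₂ : Type u) (_ : NormedAddCommGroup H₂)
      (_ : InnerProductSpace ℂ H₂) (_ : CompleteSpace H₂)
      (N : VonNeumannAlgebra H₁) (R : VonNeumannAlgebra H₂),
      N.IsFinite ∧ R.IsProperlyInfinite ∧ R.IsFactor ∧ M.IsDirectSum N R := by
  obtain ⟨z, hz, hzc, hzfin, hmax⟩ := M.exists_greatest_finite_central
  obtain ⟨H₁, _, _, _, H₂, _, _, _, N, R, e, hez⟩ := M.exists_equiv_corner_prod hz hzc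
  have he : e.symm (1, 0) = z := by rw [← hez, e.symm_apply_apply]
  have hinf_iff : ∀ a, IsInfiniteProjection (e.symm a) ↔ IsInfiniteProjection a := fun a =>
    ⟨fun h => e.apply_symm_apply a ▸ h.map_equiv e.toStarRingEquiv,
      fun h => h.map_equiv e.symm.toStarRingEquiv⟩
  have hproj : ∀ c : R.toStarSubalgebra, IsStarProjection c → c ∈ Set.center R.toStarSubalgebra →
      IsStarProjection (e.symm (0, c)) ∧
        e.symm (0, c) ∈ Set.center M.toStarSubalgebra := by
    intro c hc hcc
    have hc0 : IsStarProjection ((0, c) : N.toStarSubalgebra × R.toStarSubalgebra) :=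
      isStarProjection_iff'.2 ⟨Prod.ext (mul_zero _) hc.isIdempotentElem.eq,
        Prod.ext (star_zero _) hc.isSelfAdjoint.star_eq⟩
    refine ⟨hc0.map e.symm, ?_⟩
    rw [Semigroup.mem_center_iff] at hcc ⊢
    intro g
    refine e.injective ?_
    refine (map_mul e _ _).trans (.trans ?_ (map_mul e _ _).symm)
    rw [e.apply_symm_apply]
    exact Prod.ext ((mul_zero _).trans (zero_mul _).symm) (hcc _)
  -- A finite central projection of the second summand lies under `z` by maximality, yet is
  -- orthogonal to it, so it is zero.
  have hRinf : ∀ c : R.toStarSubalgebra, IsStarProjection c → c ∈ Set.center R.toStarSubalgebra →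
      c ≠ 0 → IsInfiniteProjection c := by
    intro c hc hcc hc0
    by_contra hfin
    obtain ⟨h1, h2⟩ := hproj c hc hcc
    have h3 := hmax _ h1 h2 (by rwa [hinf_iff, isInfiniteProjection_prod_right])
    rw [← he, ← map_mul] at h3
    have h4 := congrArg Prod.snd (e.symm.injective h3)
    exact hc0 (h4.symm.trans (zero_mul _))
  -- Otherwise `z = 1`, and the whole algebra would be finite.
  have h10 : (1 : R.toStarSubalgebra) ≠ 0 := by
    intro h
    have : z = 1 := by rw [← he, ← map_one e.symm]; exact congrArg _ (Prod.ext rfl h.symm)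
    exact hinf (by rwa [this] at hzfin)
  refine ⟨H₁, inferInstance, inferInstance, inferInstance, H₂, inferInstance, inferInstance,
    inferInstance, N, R, fun h => hzfin ?_, ⟨hRinf 1 (.one _) (Set.one_mem_center) h10, ?_⟩, ?_, ⟨e⟩⟩
  · rw [← he, hinf_iff, isInfiniteProjection_prod_left]
    exact h
  · intro c hc hcc
    rw [mul_one]
    exact or_iff_not_imp_left.2 (hRinf c hc hcc)
  · refine isFactor_of_forall fun c hc hcc => ?_
    by_contra hne
    rw [not_or] at hne
    obtain ⟨h1, h2⟩ := hproj c hc hcc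
    have hcc' : 1 - c ∈ Set.center R.toStarSubalgebra := by
      rw [Semigroup.mem_center_iff] at hcc ⊢
      intro g
      rw [mul_sub, sub_mul, hcc, mul_one, one_mul]
    have h3 := hRinf c hc hcc hne.1
    have h4 := hRinf (1 - c) hc.one_sub hcc' fun h => hne.2 (sub_eq_zero.1 h).symm
    rcases hM _ h1 h2 with h | h
    · exact h ((hinf_iff _).2 (isInfiniteProjection_prod_right.2 h3))
    · refine h (((hinf_iff _).2 (isInfiniteProjection_prod_right.2 h4)).of_le h1.one_sub ?_)
      rw [sub_mul, one_mul, ← map_mul]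
      have : ((0, c) : N.toStarSubalgebra × R.toStarSubalgebra) * (0, 1 - c) = 0 :=
        Prod.ext (mul_zero _) hc.mul_one_sub_self
      rw [this, map_zero, sub_zero]

end VonNeumannAlgebra

theorem theoremt {H : Type u} [NormedAddCommGroup H] [InnerProductSpace ℂ H] [CompleteSpace H]
    (M : VonNeumannAlgebra H) :
    {x : M.toStarSubalgebra | IsCStarExtremePoint x} =
        {x : M.toStarSubalgebra | star x * x = 1} ∪ {x : M.toStarSubalgebra | x * star x = 1} ↔
      (M.IsFinite ∨
        (M.IsProperlyInfinite ∧ M.IsFactor) ∨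
        ∃ (H₁ : Type u) (_ : NormedAddCommGroup H₁) (_ : InnerProductSpace ℂ H₁)
          (_ : CompleteSpace H₁) (H₂ : Type u) (_ : NormedAddCommGroup H₂)
          (_ : InnerProductSpace ℂ H₂) (_ : CompleteSpace H₂)
          (N : VonNeumannAlgebra H₁) (R : VonNeumannAlgebra H₂),
          N.IsFinite ∧ R.IsProperlyInfinite ∧ R.IsFactor ∧ M.IsDirectSum N R) := by
  constructor
  · intro h
    by_cases hfin : M.IsFinite
    · exact Or.inl hfin
    -- A properly infinite factor is also reached through this branch, with the zero algebra as
    -- finite summand.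
    · exact Or.inr (Or.inr (VonNeumannAlgebra.exists_isDirectSum_of_hasFiniteCentralSplittings
        (VonNeumannAlgebra.hasFiniteCentralSplittings_of_setOf_isCStarExtremePoint h) hfin))
  · intro h
    refine VonNeumannAlgebra.setOf_isCStarExtremePoint_of_hasFiniteCentralSplittings ?_
    rcases h with h | ⟨-, h⟩ | ⟨H₁, _, _, _, H₂, _, _, _, N, R, hN, -, hR, ⟨e⟩⟩
    · exact hasFiniteCentralSplittings_of_finite h
    · exact hasFiniteCentralSplittings_of_trivial h.eq_zero_or_eq_one
    · exact (hasFiniteCentralSplittings_prod hN hR.eq_zero_or_eq_one).of_equiv e.toStarRingEquiv
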